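/- Let $a_1,\dots,a_7,b_1,\dots,b_6,c_1,\dots,c_5,d_1,\dots,d_4\in\mathbb{C}$, and let $G$ be the simply connected (at most 2-step) nilpotent Lie group of real dimension $10$ carrying left-invariant complex 1-forms $\eta^1,\dots,\eta^5$ such that $\eta^1,\dots,\eta^5,\overline{\eta^1},\dots,\overline{\eta^5}$ is a complex coframe and, writing $\eta^{jk}=\eta^j\wedge\eta^k$, $\eta^{j\bar k}=\eta^j\wedge\overline{\eta^k}$, $$d\eta^j=0\quad(j=1,\dots,4),$$ $$\begin{aligned}d\eta^5={}&a_1\eta^{12}+a_2\eta^{13}+a_3\eta^{14}+a_4\eta^{1\bar1}+a_5\eta^{1\bar2}+a_6\eta^{1\bar3}+a_7\eta^{1\bar4}\\&+b_1\eta^{23}+b_2\eta^{24}+b_3\eta^{2\bar1}+b_4\eta^{2\bar2}+b_5\eta^{2\bar3}+b_6\eta^{2\bar4}\\&+c_1\eta^{34}+c_2\eta^{3\bar1}+c_3\eta^{3\bar2}+c_4\eta^{3\bar3}+c_5\eta^{3\bar4}\\&+d_1\eta^{4\bar1}+d_2\eta^{4\bar2}+d_3\eta^{4\bar3}+d_4\eta^{4\bar4}.\end{aligned}$$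 Let $\Gamma\subset G$ be a lattice, $M=\Gamma\backslash G$, and let $J$ be the induced complex structure on $M$, for which $\eta^1,\dots,\eta^5$ span the $(1,0)$-forms. Let $g$ be the diagonal Hermitian metric on $(M,J)$ with fundamental form $F(X,Y)=g(JX,Y)$ equal to $F=\frac i2\sum_{h=1}^5\eta^{h\bar h}$, and set $d^c=J^{-1}dJ$. Then: I) $g$ is astheno-Kähler, i.e. $\partial\bar\partial F^{3}=0$, if and only if $$\begin{aligned}2\,\mathrm{Re}\,(d_4\bar a_4+d_4\bar b_4+d_4\bar c_4+c_4\bar a_4+c_4\bar b_4+b_4\bar a_4)={}&|a_1|^2+|a_2|^2+|a_3|^2+|a_5|^2+|a_6|^2+|a_7|^2\\&+|b_1|^2+|b_2|^2+|b_3|^2+|b_5|^2+|b_6|^2\\&+|c_1|^2+|c_2|^2+|c_3|^2+|c_5|^2+|d_1|^2+|d_2|^2+|d_3|^2.\end{aligned}$$ II) Suppose $a_2=a_3=a_5=a_6=a_7=b_1=b_2=b_3=b_5=b_6=c_2=c_3=c_5=d_1=d_2=d_3=0$. Then $dd^cF^3=0$ and $dd^cF^2=0$ both hold if and only if $$\left\{\begin{array}{l}2\,\mathrm{Re}\,(d_4\bar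 a_4+d_4\bar b_4+d_4\bar c_4+c_4\bar a_4+c_4\bar b_4+b_4\bar a_4)=|a_1|^2+|c_1|^2\\ 2\,\mathrm{Re}\,(c_4\bar a_4+c_4\bar b_4+b_4\bar a_4)=|a_1|^2\\ \mathrm{Re}\,(c_4\bar b_4-d_4\bar a_4)=0\\ \mathrm{Re}\,(b_4\bar d_4-c_4\bar a_4)=0.\end{array}\right.$$ -/

import Mathlib

open scoped Manifold ContDiff Topology ComplexConjugate

noncomputable section

/-! ### Complex-valued differential forms on a manifold -/

namespace CForms

section Pointwise

variable {V : Type*} [AddCommGroup V] [Module ℝ V] [TopologicalSpace V]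

/-- The wedge product of complex-valued alternating forms,
`(α ∧ β)(v₁, …, v_{k+l}) = ∑ sign σ · α(v_{σ 1}, …, v_{σ k}) β(v_{σ (k+1)}, …, v_{σ (k+l)})`,
the sum being over `(k, l)`-shuffles `σ`. -/
def wedgeAlt {k l : ℕ} (α : V [⋀^Fin k]→L[ℝ] ℂ) (β : V [⋀^Fin l]→L[ℝ] ℂ) :
    V [⋀^Fin (k + l)]→L[ℝ] ℂ :=
  { ((LinearMap.mul' ℝ ℂ).compAlternatingMap
      (α.toAlternatingMap.domCoprod β.toAlternatingMap)).domDomCongr finSumFinEquiv with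
    cont := by
      change Continuous fun v : Fin (k + l) → V =>
        LinearMap.mul' ℝ ℂ ((∑ σ, AlternatingMap.domCoprod.summand α.toAlternatingMap
          β.toAlternatingMap σ) fun i => v (finSumFinEquiv i))
      simp only [sum_apply, map_sum]
      refine continuous_finsetSum _ fun σ _ => ?_
      induction σ using Quotient.inductionOn' with
      | h σ =>
        simp only [AlternatingMap.domCoprod.summand, Quotient.liftOn'_mk'',
          smul_apply, MultilinearMap.domDomCongr_apply,
          MultilinearMap.domCoprod_apply, map_zsmul_unit, LinearMap.mul'_apply]
        refine Continuous.const_smul (Continuous.mul ?_ ?_) _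
        · exact α.cont.comp (by fun_prop)
        · exact β.cont.comp (by fun_prop) }

/-- The angle `2 π m / (2 k + 1)`. -/
def angle (k m : ℕ) : ℝ := 2 * Real.pi * m / (2 * k + 1)

/-- The projection of complex-valued `k`-forms on a vector space with complex structure `J` onto
the forms of type `(p, q)`. The rotation `cos θ + sin θ J` pulls a form `ψ` of type `(r, s)` back
to `exp (i (r - s) θ) ψ`, so for `p + q = k` the component of type `(p, q)` is the average of
`exp (- i (p - q) θ) (cos θ + sin θ J)^* ψ` over the angles `θ = 2 π m / (2 k + 1)`, `0 ≤ m ≤ 2 k`. -/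
def typeProjAlt [IsTopologicalAddGroup V] [ContinuousConstSMul ℝ V]
    (J : V →L[ℝ] V) (p q : ℕ) {k : ℕ} (ψ : V [⋀^Fin k]→L[ℝ] ℂ) : V [⋀^Fin k]→L[ℝ] ℂ :=
  if p + q = k then
    (2 * k + 1 : ℂ)⁻¹ • ∑ m ∈ Finset.range (2 * k + 1),
      Complex.exp (-(((p : ℂ) - q) * angle k m * Complex.I)) •
        ψ.compContinuousLinearMap
          (Real.cos (angle k m) • ContinuousLinearMap.id ℝ V + Real.sin (angle k m) • J)
  else 0

end Pointwise

variable {E : Type*} [NormedAddCommGroup E] [NormedSpace ℝ E]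
variable {M : Type*} [TopologicalSpace M] [ChartedSpace E M]

variable (E M) in
/-- Complex-valued differential `k`-forms (not necessarily smooth). -/
abbrev Form (k : ℕ) : Type _ := ∀ x : M, TangentSpace 𝓘(ℝ, E) x [⋀^Fin k]→L[ℝ] ℂ

variable (E M) in
/-- Complex-valued `1`-forms, as families of linear functionals. -/
abbrev OneForm : Type _ := ∀ x : M, TangentSpace 𝓘(ℝ, E) x →L[ℝ] ℂ

variable (E M) in
/-- Families of endomorphisms of the tangent spaces. -/
abbrev EndField : Type _ :=
  ∀ x : M, TangentSpace 𝓘(ℝ, E) x →L[ℝ] TangentSpace 𝓘(ℝ, E) x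

variable (E M) in
/-- Families of bilinear forms on the tangent spaces. -/
abbrev BilinField : Type _ :=
  ∀ x : M, LinearMap.BilinForm ℝ (TangentSpace 𝓘(ℝ, E) x)

/-- A `1`-form as a differential form of degree `1`. -/
def OneForm.toForm (α : OneForm E M) : Form E M 1 := fun x =>
  ContinuousAlternatingMap.ofSubsingleton ℝ (TangentSpace 𝓘(ℝ, E) x) ℂ (0 : Fin 1) (α x)

/-- The conjugate of a complex-valued `1`-form. -/
def OneForm.conj (α : OneForm E M) : OneForm E M := fun x =>
  Complex.conjCLE.toContinuousLinearMap ∘L α x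

/-- The wedge product of differential forms. -/
def wedge {k l : ℕ} (α : Form E M k) (β : Form E M l) : Form E M (k + l) := fun x =>
  wedgeAlt (α x) (β x)

/-- The wedge powers of a `2`-form. -/
def wedgePow (F : Form E M 2) : (m : ℕ) → Form E M (2 * m)
  | 0 => fun x => ContinuousAlternatingMap.constOfIsEmpty ℝ (TangentSpace 𝓘(ℝ, E) x) (Fin 0) 1
  | m + 1 => wedge (wedgePow F m) F

/-- The expression of a differential form in the chart at `p`: its pullback by the inverse of
the chart. -/
def inChart {k : ℕ} (ψ : Form E M k) (p : M) : E → E [⋀^Fin k]→L[ℝ] ℂ := fun u =>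
  (ψ ((chartAt E p).symm u)).compContinuousLinearMap
    (mfderiv 𝓘(ℝ, E) 𝓘(ℝ, E) (chartAt E p).symm u)

/-- The exterior derivative on a manifold, computed at each point `p` in the chart at `p`. -/
def d {k : ℕ} (ψ : Form E M k) : Form E M (k + 1) := fun p =>
  (extDeriv (inChart ψ p) (chartAt E p p)).compContinuousLinearMap
    (mfderiv 𝓘(ℝ, E) 𝓘(ℝ, E) (chartAt E p) p)

/-- The action of an endomorphism field on forms,
`(A ψ)(v₁, …, v_k) = ψ(A v₁, …, A v_k)`. -/
def act (A : EndField E M) {k : ℕ} (ψ : Form E M k) : Form E M k := fun x =>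
  (ψ x).compContinuousLinearMap (A x)

/-- `d^c = J⁻¹ d J`. -/
def dc (J : EndField E M) {k : ℕ} (ψ : Form E M k) : Form E M (k + 1) :=
  act (fun x => (J x).inverse) (d (act J ψ))

/-- The projection `π^{p,q}` of differential forms onto their component of type `(p, q)`. -/
def typeProj (J : EndField E M) (p q : ℕ) {k : ℕ} (ψ : Form E M k) : Form E M k := fun x =>
  typeProjAlt (J x) p q (ψ x)

/-- `∂ = π^{p+1,q} ∘ d` on forms of type `(p, q)`. -/
def del (J : EndField E M) (p q : ℕ) {k : ℕ} (ψ : Form E M k) : Form E M (k + 1) :=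
  typeProj J (p + 1) q (d ψ)

/-- `∂̄ = π^{p,q+1} ∘ d` on forms of type `(p, q)`. -/
def delbar (J : EndField E M) (p q : ℕ) {k : ℕ} (ψ : Form E M k) : Form E M (k + 1) :=
  typeProj J p (q + 1) (d ψ)

/-- `J` is an almost complex structure, and `g` is a smooth Riemannian metric for which `J` is an
isometry. Smoothness is smoothness of the coefficients in every chart. -/
structure IsHermitianMetric (J : EndField E M) (g : BilinField E M) : Prop where
  sq_eq : ∀ (x : M) (X : TangentSpace 𝓘(ℝ, E) x), J x (J x X) = -X
  symm : ∀ (x : M) (X Y : TangentSpace 𝓘(ℝ, E) x), g x X Y = g x Y X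
  pos : ∀ (x : M) (X : TangentSpace 𝓘(ℝ, E) x), X ≠ 0 → 0 < g x X X
  isometry : ∀ (x : M) (X Y : TangentSpace 𝓘(ℝ, E) x), g x (J x X) (J x Y) = g x X Y
  smooth : ∀ (p : M) (a b : E), ContDiffOn ℝ ∞
    (fun u => g ((chartAt E p).symm u)
      (mfderiv 𝓘(ℝ, E) 𝓘(ℝ, E) (chartAt E p).symm u a)
      (mfderiv 𝓘(ℝ, E) 𝓘(ℝ, E) (chartAt E p).symm u b)) (chartAt E p).target

/-- `F` is the fundamental form of `g`: `F(X, Y) = g(J X, Y)`. -/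
def IsFundamentalForm (J : EndField E M) (g : BilinField E M) (F : Form E M 2) : Prop :=
  ∀ (x : M) (X Y : TangentSpace 𝓘(ℝ, E) x), F x ![X, Y] = (g x (J x X) Y : ℂ)

/-- A Hermitian metric `g` on a manifold of complex dimension `n` with fundamental form `F` is
astheno-Kähler if `∂ ∂̄ F^{n-2} = 0`. -/
def IsAsthenoKahler (n : ℕ) (J : EndField E M) (g : BilinField E M) : Prop :=
  IsHermitianMetric J g ∧ ∃ F : Form E M 2, IsFundamentalForm J g F ∧
    del J (n - 2) (n - 2 + 1) (delbar J (n - 2) (n - 2) (wedgePow F (n - 2))) = 0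

end CForms

/-! ### The nilpotent Lie group -/

/-- The model space `ℂ⁵`, regarded as a real vector space. -/
abbrev C5 : Type := Fin 5 → ℂ

/-- The constants in the structure equations. -/
structure StructureConstants where
  (a₁ a₂ a₃ a₄ a₅ a₆ a₇ : ℂ)
  (b₁ b₂ b₃ b₄ b₅ b₆ : ℂ)
  (c₁ c₂ c₃ c₄ c₅ : ℂ)
  (d₁ d₂ d₃ d₄ : ℂ)

namespace StructureConstants

variable (S : StructureConstants)

/-- The real bilinear form `B` on `ℂ⁵` such that the fifth coordinate of the product of `z` and `w`
in the group below is `z₅ + w₅ - B(z, w)`. The coordinates are indexed from `0`. -/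
def bil (z w : C5) : ℂ :=
  S.a₁ * z 0 * w 1 + S.a₂ * z 0 * w 2 + S.a₃ * z 0 * w 3
    + S.a₄ * z 0 * conj (w 0) + S.a₅ * z 0 * conj (w 1)
    + S.a₆ * z 0 * conj (w 2) + S.a₇ * z 0 * conj (w 3)
  + (S.b₁ * z 1 * w 2 + S.b₂ * z 1 * w 3
    + S.b₃ * z 1 * conj (w 0) + S.b₄ * z 1 * conj (w 1)
    + S.b₅ * z 1 * conj (w 2) + S.b₆ * z 1 * conj (w 3))
  + (S.c₁ * z 2 * w 3
    + S.c₂ * z 2 * conj (w 0) + S.c₃ * z 2 * conj (w 1)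
    + S.c₄ * z 2 * conj (w 2) + S.c₅ * z 2 * conj (w 3))
  + (S.d₁ * z 3 * conj (w 0) + S.d₂ * z 3 * conj (w 1)
    + S.d₃ * z 3 * conj (w 2) + S.d₄ * z 3 * conj (w 3))

/-- The group law on `ℂ⁵`. -/
def mul (z w : C5) : C5 :=
  ![z 0 + w 0, z 1 + w 1, z 2 + w 2, z 3 + w 3, z 4 + w 4 - S.bil z w]

/-- The inverse for the group law on `ℂ⁵`. -/
def inv (z : C5) : C5 := ![-z 0, -z 1, -z 2, -z 3, -z 4 - S.bil z z]

theorem mul_assoc (x y z : C5) : S.mul (S.mul x y) z = S.mul x (S.mul y z) := by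
  funext j
  fin_cases j <;> simp [mul, bil] <;> ring

theorem zero_mul (x : C5) : S.mul 0 x = x := by
  funext j
  fin_cases j <;> simp [mul, bil]

theorem inv_mul (x : C5) : S.mul (S.inv x) x = 0 := by
  funext j
  fin_cases j <;> simp [mul, inv, bil]
  ring

theorem contDiff_mul : ContDiff ℝ ∞ fun p : C5 × C5 => S.mul p.1 p.2 := by
  have h1 (j : Fin 5) : ContDiff ℝ ∞ fun p : C5 × C5 => p.1 j := by fun_prop
  have h2 (j : Fin 5) : ContDiff ℝ ∞ fun p : C5 × C5 => p.2 j := by fun_prop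
  have h3 (j : Fin 5) : ContDiff ℝ ∞ fun p : C5 × C5 => conj (p.2 j) :=
    Complex.conjCLE.contDiff.comp (h2 j)
  rw [contDiff_pi]
  intro j
  fin_cases j <;> simp only [mul, bil] <;> simp <;> fun_prop

theorem contDiff_inv : ContDiff ℝ ∞ S.inv := by
  have h1 (j : Fin 5) : ContDiff ℝ ∞ fun p : C5 => p j := by fun_prop
  have h3 (j : Fin 5) : ContDiff ℝ ∞ fun p : C5 => conj (p j) :=
    Complex.conjCLE.contDiff.comp (h1 j)
  rw [contDiff_pi]
  intro j
  fin_cases j <;> simp only [inv, bil] <;> simp <;> fun_prop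

end StructureConstants

/-- The simply connected `2`-step nilpotent Lie group `G` with the given structure constants,
realised on `ℂ⁵` with a polynomial group law. -/
def NilGroup (_S : StructureConstants) : Type := C5

namespace NilGroup

variable {S : StructureConstants}

instance : TopologicalSpace (NilGroup S) := inferInstanceAs (TopologicalSpace C5)

instance : T2Space (NilGroup S) := inferInstanceAs (T2Space C5)

instance : SimplyConnectedSpace (NilGroup S) := inferInstanceAs (SimplyConnectedSpace C5)

instance : ChartedSpace C5 (NilGroup S) := inferInstanceAs (ChartedSpace C5 C5)

instance : IsManifold 𝓘(ℝ, C5) ∞ (NilGroup S) := inferInstanceAs (IsManifold 𝓘(ℝ, C5) ∞ C5)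

instance : Mul (NilGroup S) := ⟨S.mul⟩

instance : One (NilGroup S) := ⟨(0 : C5)⟩

instance : Inv (NilGroup S) := ⟨S.inv⟩

instance : Group (NilGroup S) :=
  Group.ofLeftAxioms (S.mul_assoc) (S.zero_mul) (S.inv_mul)

theorem contMDiff_mul' : ContMDiff (𝓘(ℝ, C5).prod 𝓘(ℝ, C5)) 𝓘(ℝ, C5) ∞
    (fun p : C5 × C5 => S.mul p.1 p.2) := by
  rw [← modelWithCornersSelf_prod, chartedSpaceSelf_prod]
  exact S.contDiff_mul.contMDiff

theorem contMDiff_mul'' : ContMDiff (𝓘(ℝ, C5).prod 𝓘(ℝ, C5)) 𝓘(ℝ, C5) ∞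
    (fun p : NilGroup S × NilGroup S => (S.mul p.1 p.2 : NilGroup S)) := contMDiff_mul'

instance : LieGroup 𝓘(ℝ, C5) ∞ (NilGroup S) where
  contMDiff_mul := contMDiff_mul''
  contMDiff_inv := S.contDiff_inv.contMDiff

instance : IsTopologicalGroup (NilGroup S) :=
  topologicalGroup_of_lieGroup 𝓘(ℝ, C5) ∞

end NilGroup

/-- The quotient `M = Γ \ G` of the group by the left action of a subgroup `Γ`. -/
def Nilmanifold {S : StructureConstants} (Γ : Subgroup (NilGroup S)) : Type :=
  Quotient (QuotientGroup.rightRel Γ)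

namespace Nilmanifold

variable {S : StructureConstants} (Γ : Subgroup (NilGroup S))

instance : TopologicalSpace (Nilmanifold Γ) :=
  inferInstanceAs (TopologicalSpace (Quotient (QuotientGroup.rightRel Γ)))

/-- The projection `G → Γ \ G`. -/
def proj (x : NilGroup S) : Nilmanifold Γ := Quotient.mk (QuotientGroup.rightRel Γ) x

/-- A representative in `G` of a point of `Γ \ G`. -/
def rep (q : Nilmanifold Γ) : NilGroup S := Quotient.out (s := QuotientGroup.rightRel Γ) q

variable {Γ}

theorem proj_rep (q : Nilmanifold Γ) : proj Γ (rep Γ q) = q :=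
  Quotient.out_eq (s := QuotientGroup.rightRel Γ) q

theorem proj_eq_proj {x y : NilGroup S} : proj Γ x = proj Γ y ↔ y * x⁻¹ ∈ Γ :=
  (Quotient.eq (r := QuotientGroup.rightRel Γ)).trans QuotientGroup.rightRel_apply

theorem isLocalHomeomorph_proj [DiscreteTopology Γ] : IsLocalHomeomorph (proj Γ) := by
  have h : Topology.IsQuotientMap (proj Γ) := isQuotientMap_quotient_mk'
  exact (h.isQuotientCoveringMap_of_subgroup Γ ⟨inferInstance⟩
    proj_eq_proj).isCoveringMap.isLocalHomeomorph

/-- The quotient by a discrete subgroup is a manifold, the charts being the local inverses of the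
projection. -/
instance [DiscreteTopology Γ] : ChartedSpace C5 (Nilmanifold Γ) :=
  isLocalHomeomorph_proj.chartedSpaceOfRightInverse (g := rep Γ) proj_rep

/-- A continuous local lift of the projection through itself is a left translation. -/
theorem eventually_eq_mul [DiscreteTopology Γ] {f : NilGroup S → NilGroup S} {x : NilGroup S}
    (hf : ContinuousAt f x) (h : ∀ᶠ y in 𝓝 x, proj Γ (f y) = proj Γ y) :
    ∀ᶠ y in 𝓝 x, f y = f x * x⁻¹ * y := by
  have hx : x * (f x)⁻¹ ∈ Γ := proj_eq_proj.1 h.self_of_nhds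
  obtain ⟨U, hU, hUΓ⟩ : ∃ U ∈ 𝓝 (x * (f x)⁻¹), U ∩ (Γ : Set (NilGroup S)) = {x * (f x)⁻¹} :=
    by
      obtain ⟨U, hU, h⟩ := isDiscrete_iff_forall_mem_exists_isOpen.1
        (⟨inferInstance⟩ : IsDiscrete (Γ : Set (NilGroup S))) _ hx
      refine ⟨U, hU.mem_nhds ?_, h⟩
      have : x * (f x)⁻¹ ∈ U ∩ (Γ : Set (NilGroup S)) := h ▸ rfl
      exact this.1
  have hc : ContinuousAt (fun y => y * (f y)⁻¹) x := continuousAt_id.mul hf.inv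
  filter_upwards [hc hU, h] with y hy hy'
  have : y * (f y)⁻¹ = x * (f x)⁻¹ := by
    have : y * (f y)⁻¹ ∈ U ∩ (Γ : Set (NilGroup S)) := ⟨hy, proj_eq_proj.1 hy'⟩
    rwa [hUΓ] at this
  have h2 : f y * y⁻¹ = f x * x⁻¹ := by simpa using congrArg (·⁻¹) this
  rw [← h2]
  group

theorem proj_chartAt [DiscreteTopology Γ] (q : Nilmanifold Γ) {q' : Nilmanifold Γ}
    (h : q' ∈ (chartAt C5 q).source) : proj Γ (chartAt C5 q q') = q' :=
  (isLocalHomeomorph_proj (Γ := Γ)).apply_localInverseAt_of_mem (x := rep Γ q) h.1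

theorem chartAt_symm [DiscreteTopology Γ] (q : Nilmanifold Γ) (u : C5) :
    (chartAt C5 q).symm u = proj Γ u :=
  congrFun ((isLocalHomeomorph_proj (Γ := Γ)).localInverseAt_symm (rep Γ q)) u

theorem chartAt_self [DiscreteTopology Γ] (q : Nilmanifold Γ) : chartAt C5 q q = rep Γ q := by
  have h := (isLocalHomeomorph_proj (Γ := Γ)).localInverseAt_apply_self (x := rep Γ q)
  rw [proj_rep] at h
  exact h

instance [DiscreteTopology Γ] : IsManifold 𝓘(ℝ, C5) ∞ (Nilmanifold Γ) := by
  apply isManifold_of_contDiffOn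
  rintro _ _ ⟨q, rfl⟩ ⟨q', rfl⟩
  change ContDiffOn ℝ ∞ ((chartAt C5 q') ∘ (chartAt C5 q).symm)
    (((chartAt C5 q).symm.trans (chartAt C5 q')).source ∩ Set.range id)
  rw [Set.range_id, Set.inter_univ]
  intro u hu
  have hc : ContinuousAt ((chartAt C5 q').toFun ∘ (chartAt C5 q).symm) u :=
    ((chartAt C5 q).symm.trans (chartAt C5 q')).continuousAt hu
  have hp : ∀ᶠ y in 𝓝 u, proj Γ (((chartAt C5 q') ∘ (chartAt C5 q).symm) y) = proj Γ y := by
    filter_upwards [((chartAt C5 q).symm.trans (chartAt C5 q')).open_source.mem_nhds hu] with y hy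
    exact (proj_chartAt q' hy.2).trans (chartAt_symm q y)
  have he := eventually_eq_mul (Γ := Γ) (S := S) (x := u) hc hp
  refine ContDiffAt.contDiffWithinAt (ContDiffAt.congr_of_eventuallyEq ?_ he)
  exact (S.contDiff_mul.comp (contDiff_const.prodMk contDiff_id)).contDiffAt

end Nilmanifold

/-! ### The coframe, the complex structure and the diagonal metric -/

open CForms

/-- The composition of `dz_j` with the derivative at `x` of the left translation by `x⁻¹`. -/
def StructureConstants.etaAt (S : StructureConstants) (j : Fin 5) (x : C5) : C5 →L[ℝ] ℂ :=
  (ContinuousLinearMap.proj j : C5 →L[ℝ] ℂ) ∘L fderiv ℝ (S.mul (S.inv x)) x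

/-- The left-invariant complex `1`-form `η^j` on `G` that equals `dz_j` at the identity. The
indices `j` run from `0` to `4` instead of `1` to `5`. -/
def NilGroup.eta (S : StructureConstants) (j : Fin 5) : OneForm C5 (NilGroup S) := S.etaAt j

theorem StructureConstants.differentiable_mul (S : StructureConstants) (x : C5) :
    Differentiable ℝ (S.mul x) :=
  (S.contDiff_mul.comp (contDiff_const.prodMk contDiff_id)).differentiable (by simp)

theorem StructureConstants.etaAt_mul (S : StructureConstants) (j : Fin 5) (x y : C5) :
    S.etaAt j (S.mul x y) ∘L fderiv ℝ (S.mul x) y = S.etaAt j y := by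
  have hc := fderiv_comp y (S.differentiable_mul (S.inv (S.mul x y)) (S.mul x y))
    (S.differentiable_mul x y)
  have he : S.mul (S.inv (S.mul x y)) ∘ S.mul x = S.mul (S.inv y) := by
    funext z
    have h (a b c : NilGroup S) : (a * b)⁻¹ * (a * c) = b⁻¹ * c := by group
    exact h x y z
  rw [he] at hc
  rw [StructureConstants.etaAt, StructureConstants.etaAt, hc, ContinuousLinearMap.comp_assoc]

namespace Nilmanifold

variable {S : StructureConstants} (Γ : Subgroup (NilGroup S)) [DiscreteTopology Γ]

/-- The `1`-form `η^j` on `M = Γ \ G` induced by the left-invariant form `η^j` on `G`. -/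
def eta (j : Fin 5) : OneForm C5 (Nilmanifold Γ) := fun q =>
  NilGroup.eta S j (rep Γ q) ∘L
    (mfderiv 𝓘(ℝ, C5) 𝓘(ℝ, C5) (proj Γ) (rep Γ q)).inverse

theorem mdifferentiable_proj : MDifferentiable 𝓘(ℝ, C5) 𝓘(ℝ, C5) (proj Γ) := by
  intro x
  obtain ⟨y, hy, γ, hγ⟩ : ∃ y ∈ (chartAt C5 (proj Γ x)).target, ∃ γ ∈ Γ, γ * x = y := by
    refine ⟨rep Γ (proj Γ x), ?_, rep Γ (proj Γ x) * x⁻¹, ?_, by simp⟩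
    · exact chartAt_self (proj Γ x) ▸ mem_chart_target C5 (proj Γ x)
    · exact proj_eq_proj.1 (proj_rep _).symm
  have h1 : MDifferentiableAt 𝓘(ℝ, C5) 𝓘(ℝ, C5) (proj Γ) y :=
    ((mdifferentiableOn_atlas_symm (I := 𝓘(ℝ, C5))
      (chart_mem_atlas C5 (proj Γ x))).mdifferentiableAt
      ((chartAt C5 (proj Γ x)).open_target.mem_nhds hy)).congr_of_eventuallyEq
      (.of_forall fun u => (chartAt_symm _ u).symm)
  have h2 : MDifferentiableAt 𝓘(ℝ, C5) 𝓘(ℝ, C5) (fun z : NilGroup S => γ * z) x :=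
    ((contMDiff_mul_left (I := 𝓘(ℝ, C5)) (n := ∞) (a := γ)) x).mdifferentiableAt (by simp)
  have h3 : proj Γ ∘ (fun z => γ * z) = proj Γ := by
    funext z
    exact proj_eq_proj.2 (by simpa using Γ.inv_mem hγ.1)
  rw [← h3]
  exact MDifferentiableAt.comp x (hγ.2 ▸ h1) h2

theorem mfderiv_mul (x y : NilGroup S) :
    (mfderiv 𝓘(ℝ, C5) 𝓘(ℝ, C5) (fun z : NilGroup S => x * z) y : C5 →L[ℝ] C5) =
      fderiv ℝ (S.mul x) y := by
  exact mfderiv_eq_fderiv (𝕜 := ℝ) (E := C5) (E' := C5) (f := S.mul x) (x := y)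

theorem mfderiv_proj_rep (q : Nilmanifold Γ) :
    (mfderiv 𝓘(ℝ, C5) 𝓘(ℝ, C5) (proj Γ) (rep Γ q) : C5 →L[ℝ] C5) =
      ContinuousLinearMap.id ℝ C5 := by
  have hd := (mdifferentiable_proj Γ (rep Γ q)).mfderiv
  have hr : Set.range 𝓘(ℝ, C5) = Set.univ := Set.range_id
  rw [hr, fderivWithin_univ] at hd
  have he : Filter.EventuallyEq (α := C5) (𝓝 (rep Γ q))
      (writtenInExtChartAt 𝓘(ℝ, C5) 𝓘(ℝ, C5) (rep Γ q) (proj Γ)) id := by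
    have hm : rep Γ q ∈ (chartAt C5 (proj Γ (rep Γ q))).target := by
      have := mem_chart_target C5 (proj Γ (rep Γ q))
      rw [chartAt_self] at this
      rwa [proj_rep] at this ⊢
    filter_upwards [(chartAt C5 (proj Γ (rep Γ q))).open_target.mem_nhds hm] with u hu
    exact (congrArg (chartAt C5 (proj Γ (rep Γ q))) (chartAt_symm _ u).symm).trans
      ((chartAt C5 (proj Γ (rep Γ q))).right_inv hu)
  exact hd.trans ((Filter.EventuallyEq.fderiv_eq (𝕜 := ℝ) (E := C5) he).trans fderiv_id)

/-- The pullback to `G` of the form `η^j` on `M` is the left-invariant form `η^j` on `G`. -/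
theorem eta_proj (j : Fin 5) (x : NilGroup S) :
    eta Γ j (proj Γ x) ∘L mfderiv 𝓘(ℝ, C5) 𝓘(ℝ, C5) (proj Γ) x = NilGroup.eta S j x := by
  obtain ⟨γ, hγ, hx⟩ : ∃ γ ∈ Γ, rep Γ (proj Γ x) = γ * x :=
    ⟨rep Γ (proj Γ x) * x⁻¹, proj_eq_proj.1 (proj_rep _).symm, by simp⟩
  have h2 : MDifferentiableAt 𝓘(ℝ, C5) 𝓘(ℝ, C5) (fun z : NilGroup S => γ * z) x :=
    ((contMDiff_mul_left (I := 𝓘(ℝ, C5)) (n := ∞) (a := γ)) x).mdifferentiableAt (by simp)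
  have h3 : proj Γ ∘ (fun z => γ * z) = proj Γ := by
    funext z
    exact proj_eq_proj.2 (by simpa using Γ.inv_mem hγ)
  have h4 := mfderiv_comp x (mdifferentiable_proj Γ (γ * x)) h2
  have h5 : (mfderiv 𝓘(ℝ, C5) 𝓘(ℝ, C5) (proj Γ) (γ * x) : C5 →L[ℝ] C5) =
      ContinuousLinearMap.id ℝ C5 := hx ▸ mfderiv_proj_rep Γ (proj Γ x)
  have h6 : (mfderiv 𝓘(ℝ, C5) 𝓘(ℝ, C5) (proj Γ) x : C5 →L[ℝ] C5) = fderiv ℝ (S.mul γ) x := by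
    rw [h3] at h4
    refine Eq.trans ?_ (mfderiv_mul γ x)
    exact h4.trans (congrArg (fun L : C5 →L[ℝ] C5 => L ∘L
      (mfderiv 𝓘(ℝ, C5) 𝓘(ℝ, C5) (fun z : NilGroup S => γ * z) x : C5 →L[ℝ] C5)) h5)
  have h7 : (eta Γ j (proj Γ x) : C5 →L[ℝ] ℂ) = S.etaAt j (S.mul γ x) := by
    have h8 : (eta Γ j (proj Γ x) : C5 →L[ℝ] ℂ) =
        S.etaAt j (rep Γ (proj Γ x)) ∘L
          (ContinuousLinearMap.id ℝ C5).inverse :=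
      congrArg (fun L : C5 →L[ℝ] C5 =>
        S.etaAt j (rep Γ (proj Γ x)) ∘L L.inverse) (mfderiv_proj_rep Γ _)
    rw [ContinuousLinearMap.inverse_id, ContinuousLinearMap.comp_id] at h8
    exact h8.trans (congrArg (S.etaAt j) hx)
  exact (congrArg₂ (fun (L : C5 →L[ℝ] ℂ) (K : C5 →L[ℝ] C5) => L ∘L K) h7 h6).trans
    (S.etaAt_mul j γ x)

/-- `η^j` as a differential form of degree `1`. -/
def etaForm (j : Fin 5) : Form C5 (Nilmanifold Γ) 1 := (eta Γ j).toForm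

/-- The conjugate of `η^j` as a differential form of degree `1`. -/
def etaBar (j : Fin 5) : Form C5 (Nilmanifold Γ) 1 := (eta Γ j).conj.toForm

/-- The coframe at a point of `M`, as a linear map to `ℂ⁵`. -/
def coframe (q : Nilmanifold Γ) : TangentSpace 𝓘(ℝ, C5) q →L[ℝ] C5 :=
  ContinuousLinearMap.pi fun j => eta Γ j q

/-- The almost complex structure `J` on `M` for which `η^1, …, η^5` is a basis of the forms of
type `(1, 0)`, that is, `η^j ∘ J = i η^j`. -/
def complexStructure : EndField C5 (Nilmanifold Γ) := fun q =>
  (coframe Γ q).inverse ∘L (Complex.I • ContinuousLinearMap.id ℝ C5) ∘L coframe Γ q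

/-- The diagonal metric `g(X, Y) = ∑ₕ Re (η^h(X) conj (η^h(Y)))`. -/
def diagonalMetric : BilinField C5 (Nilmanifold Γ) := fun q =>
  ∑ h : Fin 5, (innerₗ ℂ).compl₁₂ (eta Γ h q).toLinearMap (eta Γ h q).toLinearMap

/-- `F = (i / 2) ∑ₕ η^h ∧ conj η^h`. -/
def diagonalForm : Form C5 (Nilmanifold Γ) 2 :=
  (Complex.I / 2) • ∑ h : Fin 5, wedge (etaForm Γ h) (etaBar Γ h)

/-- The right-hand side of the structure equation for `d η^5`. -/
def structureForm : Form C5 (Nilmanifold Γ) 2 :=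
  S.a₁ • wedge (etaForm Γ 0) (etaForm Γ 1) + S.a₂ • wedge (etaForm Γ 0) (etaForm Γ 2)
    + S.a₃ • wedge (etaForm Γ 0) (etaForm Γ 3)
    + S.a₄ • wedge (etaForm Γ 0) (etaBar Γ 0) + S.a₅ • wedge (etaForm Γ 0) (etaBar Γ 1)
    + S.a₆ • wedge (etaForm Γ 0) (etaBar Γ 2) + S.a₇ • wedge (etaForm Γ 0) (etaBar Γ 3)
  + (S.b₁ • wedge (etaForm Γ 1) (etaForm Γ 2) + S.b₂ • wedge (etaForm Γ 1) (etaForm Γ 3)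
    + S.b₃ • wedge (etaForm Γ 1) (etaBar Γ 0) + S.b₄ • wedge (etaForm Γ 1) (etaBar Γ 1)
    + S.b₅ • wedge (etaForm Γ 1) (etaBar Γ 2) + S.b₆ • wedge (etaForm Γ 1) (etaBar Γ 3))
  + (S.c₁ • wedge (etaForm Γ 2) (etaForm Γ 3)
    + S.c₂ • wedge (etaForm Γ 2) (etaBar Γ 0) + S.c₃ • wedge (etaForm Γ 2) (etaBar Γ 1)
    + S.c₄ • wedge (etaForm Γ 2) (etaBar Γ 2) + S.c₅ • wedge (etaForm Γ 2) (etaBar Γ 3))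
  + (S.d₁ • wedge (etaForm Γ 3) (etaBar Γ 0) + S.d₂ • wedge (etaForm Γ 3) (etaBar Γ 1)
    + S.d₃ • wedge (etaForm Γ 3) (etaBar Γ 2) + S.d₄ • wedge (etaForm Γ 3) (etaBar Γ 3))

end Nilmanifold

end

open CForms Nilmanifold

/-! The statement reduces to linear algebra on the horizontal forms η^1, …, η^4 and their
conjugates. Write T = ∑_{j≤4} η^{j j̄} and w = η^{5 5̄}, so F = (i/2)(T + w). T is closed and w² =
0, hence F^{n+1} = (i/2)^{n+1} (T^{n+1} + (n+1) T^n w). Let ω and ω' be the (2,0)- and (1,1)-parts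
of dη^5. Only w contributes to the differential, and sorting dF^{n+1} by type gives ∂∂̄F^{n+1} = c
T^n ∧ τ and dd^cF^{n+1} = 2i c T^n ∧ τ, where c ≠ 0 and τ = ω' ∧ conj ω' - ω ∧ conj ω
(`del_delbar_wedgePow`, `d_dc_wedgePow`).

Wedging τ with η^{i ī} ∧ η^{j j̄} kills every term that contains the index i or j, and leaves p_{kl}
times the horizontal volume form, where {k, l} is the complementary pair and p_{kl} is a real
quadratic expression in the constants (`mix_mul_mix_mul_torsion`, `pairCoeff_eq`). As T² = 2 ∑_{i<j}
η^{i ī} ∧ η^{j j̄}, the form T² ∧ τ vanishes exactly when the six p_{kl} add up to zero. This is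
part I.

For part II, T ∧ τ = 0 implies, after wedging with η^{i ī}, that the p_{kl} over the three pairs
avoiding i sum to zero (`pairCoeff_sum_eq_zero`). When only a₁, c₁ and the diagonal constants
survive, the four sums are also the only coefficients of T ∧ τ, so their vanishing suffices
(`trace_mul_torsion_eq_zero`). The four sums vanish if and only if the total is zero, p₁₂ + p₁₃ +
p₂₃ = 0, p₁₄ = p₂₃ and p₁₃ = p₂₄, which is the stated system.

The passage from the manifold to algebra has two stages. Forms with constant coefficients in the
coframe are read in the charts, whose inverses are the projection from G; left invariance moves the
exterior derivative to the identity (`extDeriv_comp_frame`, `d_invForm`). There it is an operator on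
the exterior algebra of complex-valued real-linear forms, given by wedging with dη^5 and its
conjugate after interior products with ∂₅ and ∂̄₅ (`leibniz_shear_extForm`). Types are detected by
the weight under the rotations cos θ + sin θ J. -/

noncomputable section

/-! ### Products of `1`-forms -/

namespace CForms

section Determinant

variable {V : Type*} [NormedAddCommGroup V] [NormedSpace ℝ V]

/-- The wedge product of `k` complex-valued `1`-forms on `V`, as a determinant. -/
def detForm {k : ℕ} (α : Fin k → V →L[ℝ] ℂ) : V [⋀^Fin k]→L[ℝ] ℂ :=
  { MultilinearMap.alternatization ((MultilinearMap.mkPiAlgebra ℝ (Fin k) ℂ).compLinearMap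
      fun i => (α i).toLinearMap) with
    cont := by
      change Continuous fun v : Fin k → V => MultilinearMap.alternatization
        ((MultilinearMap.mkPiAlgebra ℝ (Fin k) ℂ).compLinearMap fun i => (α i).toLinearMap) v
      simp only [MultilinearMap.alternatization_apply, MultilinearMap.domDomCongr_apply,
        MultilinearMap.compLinearMap_apply, MultilinearMap.mkPiAlgebra_apply,
        ContinuousLinearMap.coe_coe]
      fun_prop }

theorem toAlternatingMap_detForm {k : ℕ} (α : Fin k → V →L[ℝ] ℂ) :
    (detForm α).toAlternatingMap = MultilinearMap.alternatization
      ((MultilinearMap.mkPiAlgebra ℝ (Fin k) ℂ).compLinearMap fun i => (α i).toLinearMap) := rfl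

theorem detForm_apply {k : ℕ} (α : Fin k → V →L[ℝ] ℂ) (v : Fin k → V) :
    detForm α v = (Matrix.of fun i j => α i (v j)).det := by
  have h : detForm α v = MultilinearMap.alternatization
      ((MultilinearMap.mkPiAlgebra ℝ (Fin k) ℂ).compLinearMap fun i => (α i).toLinearMap) v := rfl
  rw [h, ← Matrix.det_transpose, Matrix.det_apply, MultilinearMap.alternatization_apply]
  simp [Matrix.transpose_apply]

theorem of_update_apply {k : ℕ} (α : Fin k → V →L[ℝ] ℂ) (v : Fin k → V) (i : Fin k)
    (β : V →L[ℝ] ℂ) : (Matrix.of fun r j => (Function.update α i β) r (v j)) =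
      (Matrix.of fun r j => α r (v j)).updateRow i (fun j => β (v j)) := by
  ext r j
  by_cases hr : r = i
  · subst hr
    simp
  · simp [Matrix.updateRow_ne, hr]

/-- `detForm` as an alternating function of the `1`-forms. -/
def detFormAlt (V : Type*) [NormedAddCommGroup V] [NormedSpace ℝ V] (k : ℕ) :
    (V →L[ℝ] ℂ) [⋀^Fin k]→ₗ[ℂ] (V [⋀^Fin k]→L[ℝ] ℂ) where
  toFun := detForm
  map_update_add' α i β γ := by
    -- The field is stated for an arbitrary decidable equality on `Fin k`; it is replaced by the
    -- canonical one so that the update lemmas match.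
    rename_i inst
    obtain rfl := Subsingleton.elim inst (instDecidableEqFin k)
    ext v
    simp only [detForm_apply, ContinuousAlternatingMap.add_apply, of_update_apply]
    exact Matrix.det_updateRow_add (R := ℂ) _ _ _ _
  map_update_smul' α i c β := by
    rename_i inst
    obtain rfl := Subsingleton.elim inst (instDecidableEqFin k)
    ext v
    simp only [detForm_apply, ContinuousAlternatingMap.smul_apply, of_update_apply]
    exact Matrix.det_updateRow_smul (R := ℂ) _ _ _ _
  map_eq_zero_of_eq' α i j hα hij := by
    ext v
    rw [detForm_apply]
    exact Matrix.det_zero_of_row_eq hij (by ext r; simp [hα])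

@[simp]
theorem detFormAlt_apply {k : ℕ} (α : Fin k → V →L[ℝ] ℂ) : detFormAlt V k α = detForm α := rfl

/-- The shuffle product of two alternatizations is the alternatization of the tensor product, with
no factorial; the two sums over permutations then match through `finSumFinEquiv`. -/
theorem wedgeAlt_detForm {k l : ℕ} (α : Fin k → V →L[ℝ] ℂ) (β : Fin l → V →L[ℝ] ℂ) :
    wedgeAlt (detForm α) (detForm β) = detForm (Fin.append α β) := by
  ext v
  have h : wedgeAlt (detForm α) (detForm β) v = LinearMap.mul' ℝ ℂ
      (((detForm α).toAlternatingMap.domCoprod (detForm β).toAlternatingMap)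
        fun i => v (finSumFinEquiv i)) := rfl
  rw [h, toAlternatingMap_detForm, toAlternatingMap_detForm,
    ← MultilinearMap.domCoprod_alternization]
  have h' : detForm (Fin.append α β) v = MultilinearMap.alternatization
      ((MultilinearMap.mkPiAlgebra ℝ (Fin (k + l)) ℂ).compLinearMap
        fun i => (Fin.append α β i).toLinearMap) v := rfl
  rw [h', MultilinearMap.alternatization_apply, MultilinearMap.alternatization_apply, map_sum]
  refine Fintype.sum_equiv (Equiv.permCongr finSumFinEquiv) _ _ fun σ => ?_
  simp [Fin.prod_univ_add, Equiv.permCongr_apply]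

theorem detForm_compContinuousLinearMap {V' : Type*} [NormedAddCommGroup V'] [NormedSpace ℝ V']
    {k : ℕ} (α : Fin k → V →L[ℝ] ℂ) (L : V' →L[ℝ] V) :
    (detForm α).compContinuousLinearMap L = detForm fun i => α i ∘L L := by
  ext v
  simp [detForm_apply]

/-- Antisymmetrising in the extra vector is the Laplace expansion of the determinant along its first
row. -/
theorem alternatizeUncurryFin_smulRight_detForm {k : ℕ} (φ : V →L[ℝ] ℂ)
    (α : Fin k → V →L[ℝ] ℂ) (f : V →L[ℝ] V [⋀^Fin k]→L[ℝ] ℂ)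
    (hf : ∀ u, f u = φ u • detForm α) :
    ContinuousAlternatingMap.alternatizeUncurryFin f = detForm (Fin.cons φ α) := by
  ext v
  rw [ContinuousAlternatingMap.alternatizeUncurryFin_apply, detForm_apply,
    Matrix.det_succ_row_zero]
  refine Finset.sum_congr rfl fun i _ => ?_
  rw [hf, ContinuousAlternatingMap.smul_apply, detForm_apply]
  simp only [Matrix.of_apply, Fin.cons_zero, smul_eq_mul, zsmul_eq_mul, Int.cast_pow,
    Int.cast_neg, Int.cast_one, mul_assoc]
  rfl

/-- The derivative of the determinant by rows and by columns. -/
theorem sum_det_updateCol_eq_sum_det_updateRow {n R : Type*} [Fintype n] [DecidableEq n]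
    [CommRing R] (A B : Matrix n n R) :
    ∑ i, (A.updateCol i (fun j => B j i)).det = ∑ i, (A.updateRow i (B i)).det := by
  -- By Cramer's rule both sums are the trace of `A.adjugate * B`.
  have h1 (i : n) : (A.updateCol i (fun j => B j i)).det = ∑ j, A.adjugate i j * B j i := by
    rw [← Matrix.cramer_apply, Matrix.cramer_eq_adjugate_mulVec]
    rfl
  have h2 (i : n) : (A.updateRow i (B i)).det = ∑ j, A.adjugate j i * B i j := by
    rw [← Matrix.cramer_transpose_apply, Matrix.cramer_eq_adjugate_mulVec,
      ← Matrix.adjugate_transpose]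
    rfl
  simp_rw [h1, h2]
  exact Finset.sum_comm

/-- The derivation of forms induced by an endomorphism, on products of `1`-forms. -/
theorem fderivComp_detForm {k : ℕ} (α : Fin k → V →L[ℝ] ℂ) (B : V →L[ℝ] V) :
    (detForm α).fderivCompContinuousLinearMap (ContinuousLinearMap.id ℝ V) B =
      ∑ i, detForm (Function.update α i (α i ∘L B)) := by
  ext v
  rw [ContinuousAlternatingMap.fderivCompContinuousLinearMap_apply,
    ContinuousAlternatingMap.sum_apply]
  simp only [detForm_apply]
  have h (i : Fin k) : (Matrix.of fun r j => α r
      ((Function.update (fun _ => ContinuousLinearMap.id ℝ V) i B j) (v j))) =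
        (Matrix.of fun r j => α r (v j)).updateCol i (fun j => α j (B (v i))) := by
    ext r j
    by_cases h : j = i
    · subst h
      simp
    · simp [h]
  simp only [h, of_update_apply]
  exact sum_det_updateCol_eq_sum_det_updateRow (Matrix.of fun i j => α i (v j))
    (Matrix.of fun i j => α i (B (v j)))

end Determinant

end CForms

namespace CForms

/-! ### Bilinearity and naturality of the wedge product -/

section Wedge

variable {V : Type*} [AddCommGroup V] [Module ℝ V] [TopologicalSpace V]

/-- Each shuffle class consists of k! l! permutations with equal contributions. Summing over all
permutations avoids the quotient, so bilinearity and naturality become termwise identities. -/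
theorem factorial_mul_wedgeAlt_apply {k l : ℕ} (α : V [⋀^Fin k]→L[ℝ] ℂ)
    (β : V [⋀^Fin l]→L[ℝ] ℂ) (v : Fin (k + l) → V) :
    ((k.factorial * l.factorial : ℕ) : ℂ) * wedgeAlt α β v =
      ∑ σ : Equiv.Perm (Fin k ⊕ Fin l), ((Equiv.Perm.sign σ : ℤ) : ℂ) *
        (α (fun i => v (finSumFinEquiv (σ (Sum.inl i)))) *
          β (fun i => v (finSumFinEquiv (σ (Sum.inr i))))) := by
  have h := congrArg (fun f => LinearMap.mul' ℝ ℂ (f fun i => v (finSumFinEquiv i)))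
    (MultilinearMap.domCoprod_alternization_eq α.toAlternatingMap β.toAlternatingMap)
  have h' : wedgeAlt α β v = LinearMap.mul' ℝ ℂ
      ((α.toAlternatingMap.domCoprod β.toAlternatingMap) fun i => v (finSumFinEquiv i)) := rfl
  simp only [MultilinearMap.alternatization_apply, map_sum, Fintype.card_fin,
    AlternatingMap.smul_apply, map_nsmul] at h
  rw [← h', nsmul_eq_mul] at h
  rw [← h]
  refine Finset.sum_congr rfl fun σ _ => ?_
  rw [Units.smul_def, map_zsmul, zsmul_eq_mul]
  rfl

theorem wedgeAlt_ext {k l : ℕ} {α : V [⋀^Fin k]→L[ℝ] ℂ} {β : V [⋀^Fin l]→L[ℝ] ℂ}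
    {γ : V [⋀^Fin (k + l)]→L[ℝ] ℂ}
    (h : ∀ v, ∑ σ : Equiv.Perm (Fin k ⊕ Fin l), ((Equiv.Perm.sign σ : ℤ) : ℂ) *
        (α (fun i => v (finSumFinEquiv (σ (Sum.inl i)))) *
          β (fun i => v (finSumFinEquiv (σ (Sum.inr i))))) =
      ((k.factorial * l.factorial : ℕ) : ℂ) * γ v) : wedgeAlt α β = γ := by
  ext v
  have hne : ((k.factorial * l.factorial : ℕ) : ℂ) ≠ 0 :=
    Nat.cast_ne_zero.2 (mul_ne_zero k.factorial_ne_zero l.factorial_ne_zero)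
  exact mul_left_cancel₀ hne ((factorial_mul_wedgeAlt_apply α β v).trans (h v))

theorem wedgeAlt_add_left {k l : ℕ} (α α' : V [⋀^Fin k]→L[ℝ] ℂ) (β : V [⋀^Fin l]→L[ℝ] ℂ) :
    wedgeAlt (α + α') β = wedgeAlt α β + wedgeAlt α' β :=
  wedgeAlt_ext fun v => by
    simp only [ContinuousAlternatingMap.add_apply, mul_add, factorial_mul_wedgeAlt_apply, add_mul,
      Finset.sum_add_distrib]

theorem wedgeAlt_add_right {k l : ℕ} (α : V [⋀^Fin k]→L[ℝ] ℂ) (β β' : V [⋀^Fin l]→L[ℝ] ℂ) :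
    wedgeAlt α (β + β') = wedgeAlt α β + wedgeAlt α β' :=
  wedgeAlt_ext fun v => by
    simp only [ContinuousAlternatingMap.add_apply, mul_add, factorial_mul_wedgeAlt_apply,
      Finset.sum_add_distrib]

theorem wedgeAlt_smul_left {k l : ℕ} (c : ℂ) (α : V [⋀^Fin k]→L[ℝ] ℂ)
    (β : V [⋀^Fin l]→L[ℝ] ℂ) : wedgeAlt (c • α) β = c • wedgeAlt α β :=
  wedgeAlt_ext fun v => by
    simp only [ContinuousAlternatingMap.smul_apply, smul_eq_mul, mul_left_comm _ c,
      factorial_mul_wedgeAlt_apply, Finset.mul_sum, mul_assoc]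

theorem wedgeAlt_smul_right {k l : ℕ} (c : ℂ) (α : V [⋀^Fin k]→L[ℝ] ℂ)
    (β : V [⋀^Fin l]→L[ℝ] ℂ) : wedgeAlt α (c • β) = c • wedgeAlt α β :=
  wedgeAlt_ext fun v => by
    simp only [ContinuousAlternatingMap.smul_apply, smul_eq_mul, mul_left_comm _ c,
      factorial_mul_wedgeAlt_apply, Finset.mul_sum]

theorem wedgeAlt_zero_left {k l : ℕ} (β : V [⋀^Fin l]→L[ℝ] ℂ) :
    wedgeAlt (0 : V [⋀^Fin k]→L[ℝ] ℂ) β = 0 := by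
  exact wedgeAlt_ext fun v => by simp

theorem wedgeAlt_zero_right {k l : ℕ} (α : V [⋀^Fin k]→L[ℝ] ℂ) :
    wedgeAlt α (0 : V [⋀^Fin l]→L[ℝ] ℂ) = 0 := by
  exact wedgeAlt_ext fun v => by simp

theorem wedgeAlt_compContinuousLinearMap {V' : Type*} [AddCommGroup V'] [Module ℝ V']
    [TopologicalSpace V'] {k l : ℕ} (α : V [⋀^Fin k]→L[ℝ] ℂ)
    (β : V [⋀^Fin l]→L[ℝ] ℂ) (L : V' →L[ℝ] V) :
    wedgeAlt (α.compContinuousLinearMap L) (β.compContinuousLinearMap L) =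
      (wedgeAlt α β).compContinuousLinearMap L :=
  wedgeAlt_ext fun v => by
    simp only [ContinuousAlternatingMap.compContinuousLinearMap_apply,
      factorial_mul_wedgeAlt_apply]
    rfl

end Wedge

/-! ### Forms as elements of the exterior algebra -/

section Exterior

variable {V : Type*} [NormedAddCommGroup V] [NormedSpace ℝ V]

/-- The component of degree `k` of an element of the exterior algebra of the space of
complex-valued `1`-forms, as an alternating form. -/
def extForm (k : ℕ) : ExteriorAlgebra ℂ (V →L[ℝ] ℂ) →ₗ[ℂ] V [⋀^Fin k]→L[ℝ] ℂ :=
  ExteriorAlgebra.liftAlternating (Pi.single k (detFormAlt V k))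

theorem extForm_ιMulti {k : ℕ} (α : Fin k → V →L[ℝ] ℂ) :
    extForm k (ExteriorAlgebra.ιMulti ℂ k α) = detForm α := by
  simp [extForm, ExteriorAlgebra.liftAlternating_apply_ιMulti]

theorem extForm_ιMulti_of_ne {k i : ℕ} (h : i ≠ k) (α : Fin i → V →L[ℝ] ℂ) :
    extForm k (ExteriorAlgebra.ιMulti ℂ i α) = 0 := by
  simp [extForm, ExteriorAlgebra.liftAlternating_apply_ιMulti, h]

/-- Both sides are bilinear, so decomposable elements suffice, where multiplication is concatenation
of the lists of factors. -/
theorem extForm_mul {k l : ℕ} {a b : ExteriorAlgebra ℂ (V →L[ℝ] ℂ)}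
    (ha : a ∈ ⋀[ℂ]^k (V →L[ℝ] ℂ)) (hb : b ∈ ⋀[ℂ]^l (V →L[ℝ] ℂ)) :
    extForm (k + l) (a * b) = wedgeAlt (extForm k a) (extForm l b) := by
  rw [← ExteriorAlgebra.ιMulti_span_fixedDegree] at ha hb
  induction ha using Submodule.span_induction with
  | mem a ha =>
    obtain ⟨α, rfl⟩ := ha
    induction hb using Submodule.span_induction with
    | mem b hb =>
      obtain ⟨β, rfl⟩ := hb
      rw [ExteriorAlgebra.ιMulti_mul_ιMulti, extForm_ιMulti, extForm_ιMulti, extForm_ιMulti,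
        wedgeAlt_detForm]
    | zero => rw [mul_zero, map_zero, map_zero, wedgeAlt_zero_right]
    | add b b' _ _ hb hb' => rw [mul_add, map_add, map_add, hb, hb', wedgeAlt_add_right]
    | smul c b _ hb => rw [mul_smul_comm, map_smul, map_smul, hb, wedgeAlt_smul_right]
  | zero => rw [zero_mul, map_zero, map_zero, wedgeAlt_zero_left]
  | add a a' _ _ ha ha' => rw [add_mul, map_add, map_add, ha, ha', wedgeAlt_add_left]
  | smul c a _ ha => rw [smul_mul_assoc, map_smul, map_smul, ha, wedgeAlt_smul_left]

theorem extForm_zero_one :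
    extForm 0 (1 : ExteriorAlgebra ℂ (V →L[ℝ] ℂ)) =
      ContinuousAlternatingMap.constOfIsEmpty ℝ V (Fin 0) 1 := by
  rw [← ExteriorAlgebra.ιMulti_zero_apply (R := ℂ) (Fin.elim0 : Fin 0 → V →L[ℝ] ℂ),
    extForm_ιMulti]
  ext v
  simp [detForm_apply]

theorem extForm_one_ι (α : V →L[ℝ] ℂ) :
    extForm 1 (ExteriorAlgebra.ι ℂ α) =
      ContinuousAlternatingMap.ofSubsingleton ℝ V ℂ (0 : Fin 1) α := by
  have h : ExteriorAlgebra.ι ℂ α = ExteriorAlgebra.ιMulti ℂ 1 ![α] := by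
    simp [ExteriorAlgebra.ιMulti_apply]
  rw [h, extForm_ιMulti]
  ext v
  simp [detForm_apply]

/-- The pullback of `1`-forms by a linear map. -/
def pullbackOne (L : V →L[ℝ] V) : (V →L[ℝ] ℂ) →ₗ[ℂ] (V →L[ℝ] ℂ) where
  toFun α := α ∘L L
  map_add' _ _ := rfl
  map_smul' _ _ := rfl

@[simp]
theorem pullbackOne_apply (L : V →L[ℝ] V) (α : V →L[ℝ] ℂ) : pullbackOne L α = α ∘L L := rfl

theorem extForm_map_pullbackOne (k : ℕ) (L : V →L[ℝ] V) (a : ExteriorAlgebra ℂ (V →L[ℝ] ℂ)) :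
    extForm k (ExteriorAlgebra.map (pullbackOne L) a) =
      (extForm k a).compContinuousLinearMap L := by
  let c : (V [⋀^Fin k]→L[ℝ] ℂ) →ₗ[ℂ] (V [⋀^Fin k]→L[ℝ] ℂ) :=
    { toFun := fun ψ => ψ.compContinuousLinearMap L
      map_add' := fun _ _ => rfl
      map_smul' := fun _ _ => rfl }
  have h : (extForm k).comp (ExteriorAlgebra.map (pullbackOne L)).toLinearMap =
      c.comp (extForm k) := by
    refine ExteriorAlgebra.lhom_ext fun i => ?_
    ext1 α
    change extForm k (ExteriorAlgebra.map (pullbackOne L) (ExteriorAlgebra.ιMulti ℂ i α)) =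
      c (extForm k (ExteriorAlgebra.ιMulti ℂ i α))
    rw [ExteriorAlgebra.map_apply_ιMulti]
    by_cases hi : i = k
    · subst hi
      rw [extForm_ιMulti, extForm_ιMulti]
      exact (detForm_compContinuousLinearMap α L).symm
    · rw [extForm_ιMulti_of_ne hi, extForm_ιMulti_of_ne hi, map_zero]
  exact LinearMap.congr_fun h a

/-- The antisymmetrised derivation of forms defined by a family of endomorphisms depending
linearly on a vector. -/
def leibniz (B : V →L[ℝ] V →L[ℝ] V) {k : ℕ} (ψ : V [⋀^Fin k]→L[ℝ] ℂ) :
    V [⋀^Fin (k + 1)]→L[ℝ] ℂ :=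
  ContinuousAlternatingMap.alternatizeUncurryFin
    (ψ.fderivCompContinuousLinearMap (ContinuousLinearMap.id ℝ V) ∘L B)

/-- `leibniz` as a linear map. -/
def leibnizLinear (B : V →L[ℝ] V →L[ℝ] V) (k : ℕ) :
    (V [⋀^Fin k]→L[ℝ] ℂ) →ₗ[ℂ] (V [⋀^Fin (k + 1)]→L[ℝ] ℂ) where
  toFun := leibniz B
  map_add' ψ ψ' := by
    ext v
    simp [leibniz, ContinuousAlternatingMap.alternatizeUncurryFin_apply,
      ContinuousAlternatingMap.fderivCompContinuousLinearMap_apply, Finset.sum_add_distrib]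
  map_smul' c ψ := by
    ext v
    simp [leibniz, ContinuousAlternatingMap.alternatizeUncurryFin_apply,
      ContinuousAlternatingMap.fderivCompContinuousLinearMap_apply, Finset.mul_sum,
      mul_left_comm]

open CliffordAlgebra in
-- The operator ψ ∧ ι_l is the derivation of the exterior algebra extending the rank one map α ↦
-- l(α) ψ. In the induction the sign of the antiderivation ι_l cancels the sign from moving ψ past
-- the first factor.
theorem ι_mul_contractLeft_ιMulti {W : Type*} [AddCommGroup W] [Module ℂ W]
    (l : Module.Dual ℂ W) (ψ : W) {k : ℕ} (α : Fin k → W) :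
    ExteriorAlgebra.ι ℂ ψ * contractLeft l (ExteriorAlgebra.ιMulti ℂ k α) =
      ∑ i, l (α i) • ExteriorAlgebra.ιMulti ℂ k (Function.update α i ψ) := by
  induction k with
  | zero => simp [ExteriorAlgebra.ιMulti_zero_apply]
  | succ k ih =>
    have hs : ExteriorAlgebra.ι ℂ ψ * ExteriorAlgebra.ι ℂ (α 0) =
        -(ExteriorAlgebra.ι ℂ (α 0) * ExteriorAlgebra.ι ℂ ψ) :=
      eq_neg_of_add_eq_zero_left (ExteriorAlgebra.ι_add_mul_swap ψ (α 0))
    have hc := contractLeft_ι_mul (Q := (0 : QuadraticForm ℂ W)) l (α 0)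
      (ExteriorAlgebra.ιMulti ℂ k (Matrix.vecTail α))
    rw [ExteriorAlgebra.ιMulti_succ_apply]
    refine (congrArg (ExteriorAlgebra.ι ℂ ψ * ·) hc).trans ?_
    have hs' : ExteriorAlgebra.ι ℂ ψ * (ExteriorAlgebra.ι ℂ (α 0) *
        contractLeft l (ExteriorAlgebra.ιMulti ℂ k (Matrix.vecTail α))) =
      -(ExteriorAlgebra.ι ℂ (α 0) * (ExteriorAlgebra.ι ℂ ψ *
        contractLeft l (ExteriorAlgebra.ιMulti ℂ k (Matrix.vecTail α)))) := by
      rw [← mul_assoc, hs, neg_mul, mul_assoc]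
    refine (mul_sub _ _ _).trans ?_
    rw [mul_smul_comm]
    refine (congrArg (l (α 0) • (ExteriorAlgebra.ι ℂ ψ *
      ExteriorAlgebra.ιMulti ℂ k (Matrix.vecTail α)) - ·) hs').trans ?_
    rw [ih, sub_neg_eq_add, Fin.sum_univ_succ, Finset.mul_sum]
    congr 1
    · rw [ExteriorAlgebra.ιMulti_succ_apply, Function.update_self]
      rfl
    · refine Finset.sum_congr rfl fun i _ => ?_
      rw [mul_smul_comm, ExteriorAlgebra.ιMulti_succ_apply,
        Function.update_of_ne (Fin.succ_ne_zero i).symm]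
      congr 3
      ext j
      by_cases h : j = i
      · subst h
        simp [Matrix.vecTail]
      · simp [Matrix.vecTail, h]

/-- The hypothesis `hB` splits the action of `B u` on 1-forms into rank one maps, each of which
extends to forms as ψ_t ∧ ι_{l_t} with the scalar factor φ_t(u). Antisymmetrising in u turns this
scalar into a wedge with φ_t in front. -/
theorem leibniz_extForm {τ : Type*} [Fintype τ] (B : V →L[ℝ] V →L[ℝ] V)
    (l : τ → Module.Dual ℂ (V →L[ℝ] ℂ)) (φ ψ : τ → V →L[ℝ] ℂ)
    (hB : ∀ (α : V →L[ℝ] ℂ) (u : V), α ∘L B u = ∑ t, (l t α * φ t u) • ψ t)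
    (k : ℕ) (a : ExteriorAlgebra ℂ (V →L[ℝ] ℂ)) :
    leibniz B (extForm k a) = extForm (k + 1) (∑ t,
      ExteriorAlgebra.ι ℂ (φ t) * (ExteriorAlgebra.ι ℂ (ψ t) *
        CliffordAlgebra.contractLeft (l t) a)) := by
  let D : ExteriorAlgebra ℂ (V →L[ℝ] ℂ) →ₗ[ℂ] ExteriorAlgebra ℂ (V →L[ℝ] ℂ) :=
    ∑ t, LinearMap.mulLeft ℂ (ExteriorAlgebra.ι ℂ (φ t)) ∘ₗ
      LinearMap.mulLeft ℂ (ExteriorAlgebra.ι ℂ (ψ t)) ∘ₗ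
        CliffordAlgebra.contractLeft (Q := (0 : QuadraticForm ℂ (V →L[ℝ] ℂ))) (l t)
  have hD (b) : D b = ∑ t, ExteriorAlgebra.ι ℂ (φ t) * (ExteriorAlgebra.ι ℂ (ψ t) *
      CliffordAlgebra.contractLeft (l t) b) := by
    simp [D]
  have h : (leibnizLinear B k).comp (extForm k) = (extForm (k + 1)).comp D := by
    refine ExteriorAlgebra.lhom_ext fun i => ?_
    ext1 α
    change leibniz B (extForm k (ExteriorAlgebra.ιMulti ℂ i α)) =
      extForm (k + 1) (D (ExteriorAlgebra.ιMulti ℂ i α))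
    have h2 (t : τ) (j : Fin i) : ExteriorAlgebra.ι ℂ (φ t) *
        ExteriorAlgebra.ιMulti ℂ i (Function.update α j (ψ t)) =
        ExteriorAlgebra.ιMulti ℂ (i + 1) (Fin.cons (φ t) (Function.update α j (ψ t))) := by
      rw [ExteriorAlgebra.ιMulti_succ_apply]
      rfl
    simp only [hD, ι_mul_contractLeft_ιMulti, Finset.mul_sum, mul_smul_comm, map_sum, map_smul, h2]
    by_cases hi : i = k
    · subst hi
      simp only [extForm_ιMulti]
      have h3 (t : τ) (j : Fin i) : detForm (Fin.cons (φ t) (Function.update α j (ψ t))) =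
          ContinuousAlternatingMap.alternatizeUncurryFin
            ((φ t).smulRight (detForm (Function.update α j (ψ t)))) :=
        (alternatizeUncurryFin_smulRight_detForm _ _ _ fun u => by ext v; simp).symm
      simp only [h3]
      rw [leibniz]
      ext v
      simp only [ContinuousAlternatingMap.alternatizeUncurryFin_apply,
        ContinuousLinearMap.comp_apply, fderivComp_detForm, hB,
        ContinuousAlternatingMap.sum_apply, ContinuousAlternatingMap.smul_apply]
      simp only [← detFormAlt_apply, AlternatingMap.map_update_sum, AlternatingMap.map_update_smul]
      simp only [ContinuousAlternatingMap.sum_apply, ContinuousLinearMap.smulRight_apply,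
        ContinuousAlternatingMap.smul_apply, zsmul_eq_mul, smul_eq_mul, Finset.mul_sum]
      -- Only the order of summation differs: the position of the extra vector, the slot acted on,
      -- and the rank one term.
      rw [Finset.sum_comm_cycle]
      refine Finset.sum_congr rfl fun t _ => ?_
      rw [Finset.sum_comm]
      refine Finset.sum_congr rfl fun j _ => Finset.sum_congr rfl fun r _ => ?_
      ring
    · have hi' : i + 1 ≠ k + 1 := by omega
      simp only [extForm_ιMulti_of_ne hi, extForm_ιMulti_of_ne hi']
      refine (leibnizLinear B k).map_zero.trans (Eq.symm ?_)
      exact Finset.sum_eq_zero fun t _ => Finset.sum_eq_zero fun j _ => by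
        ext v
        simp
  exact (LinearMap.congr_fun h a).trans (congrArg (extForm (k + 1)) (hD a))

end Exterior

end CForms

/-! ### The left-invariant coframe -/

namespace StructureConstants

variable (S : StructureConstants)

/-- The coefficients of `η^j ∧ η^k` in `d η^5`. -/
def coeffHol : Fin 4 → Fin 4 → ℂ :=
  ![![0, S.a₁, S.a₂, S.a₃], ![0, 0, S.b₁, S.b₂], ![0, 0, 0, S.c₁], ![0, 0, 0, 0]]

/-- The coefficients of `η^j ∧ conj η^k` in `d η^5`. -/
def coeffMix : Fin 4 → Fin 4 → ℂ :=
  ![![S.a₄, S.a₅, S.a₆, S.a₇], ![S.b₃, S.b₄, S.b₅, S.b₆], ![S.c₂, S.c₃, S.c₄, S.c₅],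
    ![S.d₁, S.d₂, S.d₃, S.d₄]]

end StructureConstants

/-- The linear form `z ↦ z_j` on `ℂ⁵`. -/
def dz (j : Fin 5) : C5 →L[ℝ] ℂ := ContinuousLinearMap.proj j

/-- The linear form `z ↦ conj z_j` on `ℂ⁵`. -/
def dzBar (j : Fin 5) : C5 →L[ℝ] ℂ := Complex.conjCLE.toContinuousLinearMap ∘L dz j

@[simp]
theorem dz_apply (j : Fin 5) (z : C5) : dz j z = z j := rfl

@[simp]
theorem dzBar_apply (j : Fin 5) (z : C5) : dzBar j z = conj (z j) := rfl

namespace StructureConstants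

variable (S : StructureConstants)

/-- The bilinear form `S.bil` as a continuous bilinear map. -/
def bilCLM : C5 →L[ℝ] C5 →L[ℝ] ℂ :=
  ∑ j : Fin 4, ∑ k : Fin 4,
    ((S.coeffHol j k • dz j.castSucc).smulRight (dz k.castSucc) +
      (S.coeffMix j k • dz j.castSucc).smulRight (dzBar k.castSucc))

theorem bilCLM_apply_eq_sum (z w : C5) : S.bilCLM z w = ∑ j : Fin 4, ∑ k : Fin 4,
    (S.coeffHol j k * z j.castSucc * w k.castSucc +
      S.coeffMix j k * z j.castSucc * conj (w k.castSucc)) := by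
  simp only [bilCLM, sum_apply, add_apply,
    ContinuousLinearMap.smulRight_apply, smul_apply, dz_apply, dzBar_apply,
    smul_eq_mul]

theorem bilCLM_apply (z w : C5) : S.bilCLM z w = S.bil z w := by
  have h0 : Fin.castSucc (0 : Fin 4) = 0 := rfl
  have h1 : Fin.castSucc (1 : Fin 4) = 1 := rfl
  have h2 : Fin.castSucc (2 : Fin 4) = 2 := rfl
  have h3 : Fin.castSucc (3 : Fin 4) = 3 := rfl
  rw [bilCLM_apply_eq_sum]
  simp only [Fin.sum_univ_four, h0, h1, h2, h3, bil, coeffHol, coeffMix,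
    Matrix.cons_val]
  ring

/-- The endomorphism `w ↦ B(z, w) ∂₅`. -/
def shear : C5 →L[ℝ] C5 →L[ℝ] C5 :=
  ContinuousLinearMap.compL ℝ C5 ℂ C5
    (ContinuousLinearMap.single ℝ (fun _ : Fin 5 => ℂ) 4) ∘L S.bilCLM

theorem shear_apply (z w : C5) : S.shear z w = Pi.single 4 (S.bil z w) := by
  simp [shear, bilCLM_apply]

/-- The form B ignores the fifth coordinate, while the shear takes values in it. This nilpotency
makes id minus the shear the inverse of the coframe. -/
theorem shear_shear (z w u : C5) : S.shear z (S.shear w u) = 0 := by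
  simp [shear_apply, bil]

/-- The left-invariant coframe on the group `G`, as a function on `ℂ⁵`. -/
def frame (x : C5) : C5 →L[ℝ] C5 := ContinuousLinearMap.id ℝ C5 + S.shear x

/-- Left translations are affine because B is bilinear, so the derivative of this one is its linear
part. -/
theorem mul_inv_eq (x : C5) : S.mul (S.inv x) = fun z => S.frame x z + S.inv x := by
  funext z j
  fin_cases j <;> simp [frame, shear_apply, mul, inv, bil] <;> ring

theorem fderiv_mul_inv (x : C5) : fderiv ℝ (S.mul (S.inv x)) x = S.frame x := by
  rw [mul_inv_eq]
  exact ((S.frame x).hasFDerivAt.add_const _).fderiv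

theorem etaAt_eq (j : Fin 5) (x : C5) : S.etaAt j x = dz j ∘L S.frame x := by
  rw [etaAt, fderiv_mul_inv]
  rfl

theorem frame_mul (x y : C5) : S.frame (S.mul x y) ∘L fderiv ℝ (S.mul x) y = S.frame y := by
  ext w j
  have h := congrArg (fun f => f w) (S.etaAt_mul j x y)
  simpa [etaAt_eq] using h

theorem frame_zero : S.frame 0 = ContinuousLinearMap.id ℝ C5 := by
  simp [frame]

/-- The left-invariant coframe at a point, as an isomorphism. -/
def frameEquiv (x : C5) : C5 ≃L[ℝ] C5 :=
  ContinuousLinearEquiv.equivOfInverse (S.frame x) (ContinuousLinearMap.id ℝ C5 - S.shear x)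
    (fun w => by simp [frame, shear_shear]) (fun w => by simp [frame, shear_shear])

theorem contDiff_frame : ContDiff ℝ ∞ S.frame := contDiff_const.add S.shear.contDiff

theorem hasFDerivAt_frame (x : C5) : HasFDerivAt S.frame S.shear x :=
  S.shear.hasFDerivAt.const_add _

theorem hasFDerivAt_comp_frame {k : ℕ} (A : C5 [⋀^Fin k]→L[ℝ] ℂ) (x : C5) :
    HasFDerivAt (fun y => A.compContinuousLinearMap (S.frame y))
      (A.fderivCompContinuousLinearMap (S.frame x) ∘L S.shear) x := by
  simpa using (hasFDerivAt_const A x).continuousAlternatingMapCompContinuousLinearMap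
    (S.hasFDerivAt_frame x)

/-- Left translation by the inverse of x pulls the form back to itself and carries x to the
identity. Naturality of the exterior derivative therefore leaves a computation at 0, where the
coframe is the identity and its derivative is the shear. -/
theorem extDeriv_comp_frame {k : ℕ} (A : C5 [⋀^Fin k]→L[ℝ] ℂ) (x : C5) :
    extDeriv (fun y => A.compContinuousLinearMap (S.frame y)) x =
      (leibniz S.shear A).compContinuousLinearMap (S.frame x) := by
  have hd : DifferentiableAt ℝ (fun y => A.compContinuousLinearMap (S.frame y))
      (S.mul (S.inv x) x) := (S.hasFDerivAt_comp_frame A _).differentiableAt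
  have hf : ContDiffAt ℝ ∞ (S.mul (S.inv x)) x :=
    (S.contDiff_mul.comp (contDiff_const.prodMk contDiff_id)).contDiffAt
  have h := extDeriv_pullback hd hf (by
    simpa using (WithTop.coe_le_coe.2 le_top : ((2 : ℕ∞) : WithTop ℕ∞) ≤ ∞))
  rw [S.inv_mul, S.fderiv_mul_inv] at h
  have h0 : extDeriv (fun y => A.compContinuousLinearMap (S.frame y)) 0 = leibniz S.shear A := by
    rw [extDeriv, (S.hasFDerivAt_comp_frame A 0).fderiv, frame_zero, leibniz]
  rw [h0] at h
  rw [← h]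
  congr 1
  funext y
  ext v
  simp only [ContinuousAlternatingMap.compContinuousLinearMap_apply, Function.comp_def]
  have hy (w : C5) : S.frame (S.mul (S.inv x) y) (fderiv ℝ (S.mul (S.inv x)) y w) = S.frame y w :=
    congrArg (fun f => f w) (S.frame_mul (S.inv x) y)
  simp only [hy]

end StructureConstants

/-- A map intertwining the complex structures intertwines the rotations over which the projection
averages. -/
theorem CForms.typeProjAlt_compContinuousLinearMap {V V' : Type*}
    [AddCommGroup V] [Module ℝ V] [TopologicalSpace V] [IsTopologicalAddGroup V]
    [ContinuousConstSMul ℝ V] [AddCommGroup V'] [Module ℝ V'] [TopologicalSpace V']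
    [IsTopologicalAddGroup V'] [ContinuousConstSMul ℝ V'] {J : V →L[ℝ] V} {J' : V' →L[ℝ] V'}
    (C : V →L[ℝ] V') (hC : ∀ X, C (J X) = J' (C X)) (p q : ℕ) {k : ℕ}
    (A : V' [⋀^Fin k]→L[ℝ] ℂ) :
    typeProjAlt J p q (A.compContinuousLinearMap C) =
      (typeProjAlt J' p q A).compContinuousLinearMap C := by
  ext v
  by_cases h : p + q = k
  · simp [typeProjAlt, if_pos h, ContinuousAlternatingMap.sum_apply, hC, Function.comp_def]
  · simp [typeProjAlt, if_neg h]

/-! ### Invariant forms on the nilmanifold -/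

namespace Nilmanifold

variable {S : StructureConstants} (Γ : Subgroup (NilGroup S)) [DiscreteTopology Γ]

theorem eta_eq (j : Fin 5) (q : Nilmanifold Γ) :
    (eta Γ j q : C5 →L[ℝ] ℂ) = dz j ∘L S.frame (rep Γ q) := by
  have h8 : (eta Γ j q : C5 →L[ℝ] ℂ) =
      S.etaAt j (rep Γ q) ∘L (ContinuousLinearMap.id ℝ C5).inverse :=
    congrArg (fun L : C5 →L[ℝ] C5 => S.etaAt j (rep Γ q) ∘L L.inverse) (mfderiv_proj_rep Γ _)
  rw [ContinuousLinearMap.inverse_id, ContinuousLinearMap.comp_id] at h8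
  exact h8.trans (S.etaAt_eq j _)

theorem coframe_eq (q : Nilmanifold Γ) : (coframe Γ q : C5 →L[ℝ] C5) = S.frame (rep Γ q) := by
  ext w j
  exact congrArg (fun f : C5 →L[ℝ] ℂ => f w) (eta_eq Γ j q)

/-- Differentiating in a chart needs the coframe at points of G near the chosen representative, not
only at representatives themselves. -/
theorem coframe_proj (x : C5) :
    (coframe Γ (proj Γ x) ∘L mfderiv 𝓘(ℝ, C5) 𝓘(ℝ, C5) (proj Γ) x : C5 →L[ℝ] C5) =
      S.frame x := by
  ext w j
  have h := congrArg (fun f : C5 →L[ℝ] ℂ => f w) (eta_proj Γ j x)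
  refine Eq.trans h ?_
  exact congrArg (fun f : C5 →L[ℝ] ℂ => f w) (S.etaAt_eq j x)

theorem mfderiv_chartAt_symm (p : Nilmanifold Γ) (u : C5) :
    (mfderiv 𝓘(ℝ, C5) 𝓘(ℝ, C5) (chartAt C5 p).symm u : C5 →L[ℝ] C5) =
      mfderiv 𝓘(ℝ, C5) 𝓘(ℝ, C5) (proj Γ) u := by
  have h : ((chartAt C5 p).symm : C5 → Nilmanifold Γ) = proj Γ := funext (chartAt_symm p)
  rw [h]
  rfl

theorem mfderiv_chartAt (p : Nilmanifold Γ) :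
    (mfderiv 𝓘(ℝ, C5) 𝓘(ℝ, C5) (chartAt C5 p) p : C5 →L[ℝ] C5) =
      ContinuousLinearMap.id ℝ C5 := by
  have hd := (mdifferentiableAt_atlas (I := 𝓘(ℝ, C5)) (chart_mem_atlas C5 p)
    (mem_chart_source C5 p)).mfderiv
  have hr : Set.range 𝓘(ℝ, C5) = Set.univ := Set.range_id
  rw [hr, fderivWithin_univ] at hd
  have he : Filter.EventuallyEq (α := C5) (𝓝 (chartAt C5 p p))
      (writtenInExtChartAt 𝓘(ℝ, C5) 𝓘(ℝ, C5) p (chartAt C5 p)) id := by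
    filter_upwards [(chartAt C5 p).open_target.mem_nhds (mem_chart_target C5 p)] with u hu
    exact (chartAt C5 p).right_inv hu
  exact hd.trans ((Filter.EventuallyEq.fderiv_eq (𝕜 := ℝ) (E := C5) he).trans fderiv_id)

/-- The form on `M` with constant coefficients with respect to the coframe `η^1, …, η^5`. -/
def invForm {k : ℕ} (A : C5 [⋀^Fin k]→L[ℝ] ℂ) : Form C5 (Nilmanifold Γ) k := fun q =>
  A.compContinuousLinearMap (coframe Γ q)

theorem invForm_eq {k : ℕ} (A : C5 [⋀^Fin k]→L[ℝ] ℂ) (q : Nilmanifold Γ) :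
    (invForm Γ A q : C5 [⋀^Fin k]→L[ℝ] ℂ) = A.compContinuousLinearMap (S.frame (rep Γ q)) :=
  congrArg (fun L : C5 →L[ℝ] C5 => A.compContinuousLinearMap L) (coframe_eq Γ q)

theorem inChart_invForm {k : ℕ} (A : C5 [⋀^Fin k]→L[ℝ] ℂ) (p : Nilmanifold Γ) :
    inChart (invForm Γ A) p = fun u => A.compContinuousLinearMap (S.frame u) := by
  funext u
  have h1 : (inChart (invForm Γ A) p u : C5 [⋀^Fin k]→L[ℝ] ℂ) =
      A.compContinuousLinearMap ((coframe Γ ((chartAt C5 p).symm u) : C5 →L[ℝ] C5) ∘L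
        (mfderiv 𝓘(ℝ, C5) 𝓘(ℝ, C5) (chartAt C5 p).symm u : C5 →L[ℝ] C5)) := rfl
  rw [h1, chartAt_symm, mfderiv_chartAt_symm]
  exact congrArg (fun L : C5 →L[ℝ] C5 => A.compContinuousLinearMap L) (coframe_proj Γ u)

theorem d_invForm {k : ℕ} (A : C5 [⋀^Fin k]→L[ℝ] ℂ) :
    d (invForm Γ A) = invForm Γ (leibniz S.shear A) := by
  funext p
  have h1 : (d (invForm Γ A) p : C5 [⋀^Fin (k + 1)]→L[ℝ] ℂ) =
      (extDeriv (inChart (invForm Γ A) p) (chartAt C5 p p)).compContinuousLinearMap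
        (ContinuousLinearMap.id ℝ C5) :=
    congrArg (fun L : C5 →L[ℝ] C5 => (extDeriv (inChart (invForm Γ A) p)
      (chartAt C5 p p)).compContinuousLinearMap L) (mfderiv_chartAt Γ p)
  rw [inChart_invForm, S.extDeriv_comp_frame, chartAt_self] at h1
  exact h1.trans (invForm_eq Γ (leibniz S.shear A) p).symm

theorem invForm_add {k : ℕ} (A B : C5 [⋀^Fin k]→L[ℝ] ℂ) :
    invForm Γ (A + B) = invForm Γ A + invForm Γ B := rfl

theorem invForm_smul {k : ℕ} (c : ℂ) (A : C5 [⋀^Fin k]→L[ℝ] ℂ) :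
    invForm Γ (c • A) = c • invForm Γ A := rfl

/-- The form with constant coefficients depends linearly on the coefficients. -/
def invFormLinear (k : ℕ) : (C5 [⋀^Fin k]→L[ℝ] ℂ) →ₗ[ℂ] Form C5 (Nilmanifold Γ) k where
  toFun := invForm Γ
  map_add' := invForm_add Γ
  map_smul' := invForm_smul Γ

/-- The coframe is an isomorphism at each point, so a single point decides; the image of the
identity is used. -/
theorem invForm_eq_zero {k : ℕ} {A : C5 [⋀^Fin k]→L[ℝ] ℂ} : invForm Γ A = 0 ↔ A = 0 := by
  refine ⟨fun h => ?_, fun h => h ▸ (invFormLinear Γ k).map_zero⟩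
  have h1 : A.compContinuousLinearMap (S.frame (rep Γ (proj Γ (1 : NilGroup S)))) = 0 :=
    (invForm_eq Γ A _).symm.trans (congrFun h _)
  ext v
  have h2 := congrArg (fun f => f fun i => (S.frameEquiv (rep Γ (proj Γ 1))).symm (v i)) h1
  have h3 (w : C5) : S.frame (rep Γ (proj Γ 1)) ((S.frameEquiv (rep Γ (proj Γ 1))).symm w) = w :=
    (S.frameEquiv _).apply_symm_apply w
  simpa [h3, Function.comp_def] using h2

theorem wedge_invForm {k l : ℕ} (A : C5 [⋀^Fin k]→L[ℝ] ℂ) (B : C5 [⋀^Fin l]→L[ℝ] ℂ) :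
    wedge (invForm Γ A) (invForm Γ B) = invForm Γ (wedgeAlt A B) := by
  funext q
  exact wedgeAlt_compContinuousLinearMap A B (coframe Γ q)

theorem etaForm_eq (j : Fin 5) :
    etaForm Γ j = invForm Γ (extForm 1 (ExteriorAlgebra.ι ℂ (dz j))) := by
  rw [extForm_one_ι]
  rfl

theorem etaBar_eq (j : Fin 5) :
    etaBar Γ j = invForm Γ (extForm 1 (ExteriorAlgebra.ι ℂ (dzBar j))) := by
  rw [extForm_one_ι]
  rfl

/-- Multiplication by `i` on `ℂ⁵`. -/
def mulI : C5 →L[ℝ] C5 := Complex.I • ContinuousLinearMap.id ℝ C5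

theorem isInvertible_coframe (q : Nilmanifold Γ) : (coframe Γ q).IsInvertible :=
  ⟨S.frameEquiv (rep Γ q), (coframe_eq Γ q).symm⟩

theorem coframe_complexStructure (q : Nilmanifold Γ) (X : TangentSpace 𝓘(ℝ, C5) q) :
    coframe Γ q (complexStructure Γ q X) = Complex.I • coframe Γ q X :=
  (isInvertible_coframe Γ q).self_apply_inverse _

theorem coframe_injective (q : Nilmanifold Γ) : Function.Injective (coframe Γ q) :=
  (isInvertible_coframe Γ q).injective

theorem eta_complexStructure (j : Fin 5) (q : Nilmanifold Γ) (X : TangentSpace 𝓘(ℝ, C5) q) :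
    eta Γ j q (complexStructure Γ q X) = Complex.I * eta Γ j q X :=
  congrFun (coframe_complexStructure Γ q X) j

theorem complexStructure_sq (q : Nilmanifold Γ) (X : TangentSpace 𝓘(ℝ, C5) q) :
    complexStructure Γ q (complexStructure Γ q X) = -X := by
  apply coframe_injective Γ q
  rw [coframe_complexStructure, coframe_complexStructure, smul_smul, Complex.I_mul_I, map_neg,
    neg_one_smul]

theorem inverse_complexStructure (q : Nilmanifold Γ) :
    (complexStructure Γ q).inverse = -complexStructure Γ q :=
  ContinuousLinearMap.inverse_eq
    (by ext1 X; simp [complexStructure_sq]) (by ext1 X; simp [complexStructure_sq])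

theorem act_complexStructure_invForm {k : ℕ} (A : C5 [⋀^Fin k]→L[ℝ] ℂ) :
    act (complexStructure Γ) (invForm Γ A) = invForm Γ (A.compContinuousLinearMap mulI) := by
  funext q
  ext v
  change A (fun i => coframe Γ q (complexStructure Γ q (v i))) =
    A (fun i => Complex.I • coframe Γ q (v i))
  simp only [coframe_complexStructure]

theorem act_inverse_complexStructure_invForm {k : ℕ} (A : C5 [⋀^Fin k]→L[ℝ] ℂ) :
    act (fun x => (complexStructure Γ x).inverse) (invForm Γ A) =
      invForm Γ (A.compContinuousLinearMap (-mulI)) := by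
  funext q
  ext v
  change A (fun i => coframe Γ q ((complexStructure Γ q).inverse (v i))) =
    A (fun i => -(Complex.I • coframe Γ q (v i)))
  simp only [inverse_complexStructure, neg_apply, map_neg, coframe_complexStructure]

theorem dc_invForm {k : ℕ} (A : C5 [⋀^Fin k]→L[ℝ] ℂ) :
    dc (complexStructure Γ) (invForm Γ A) = invForm Γ
      ((leibniz S.shear (A.compContinuousLinearMap mulI)).compContinuousLinearMap (-mulI)) := by
  rw [dc, act_complexStructure_invForm, d_invForm, act_inverse_complexStructure_invForm]

theorem typeProj_invForm (p q : ℕ) {k : ℕ} (A : C5 [⋀^Fin k]→L[ℝ] ℂ) :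
    typeProj (complexStructure Γ) p q (invForm Γ A) = invForm Γ (typeProjAlt mulI p q A) := by
  funext x
  exact typeProjAlt_compContinuousLinearMap (coframe Γ x) (coframe_complexStructure Γ x) p q A

end Nilmanifold

namespace Nilmanifold

/-! ### The invariant forms as elements of an exterior algebra -/

/-- The exterior algebra of the complex-valued linear forms on `ℂ⁵`. -/
abbrev FormAlg : Type := ExteriorAlgebra ℂ (C5 →L[ℝ] ℂ)

/-- The linear form `dz_j` in the exterior algebra. -/
def zeta (j : Fin 5) : FormAlg := ExteriorAlgebra.ι ℂ (dz j)

/-- The linear form `conj dz_j` in the exterior algebra. -/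
def zetaBar (j : Fin 5) : FormAlg := ExteriorAlgebra.ι ℂ (dzBar j)

/-- `(i / 2) ∑ₕ dz_h ∧ conj dz_h`. -/
def stdForm : FormAlg := (Complex.I / 2) • ∑ h : Fin 5, zeta h * zetaBar h

theorem ι_mul_ι_mem (α β : C5 →L[ℝ] ℂ) :
    (ExteriorAlgebra.ι ℂ α * ExteriorAlgebra.ι ℂ β : FormAlg) ∈ ⋀[ℂ]^2 (C5 →L[ℝ] ℂ) := by
  have h : (ExteriorAlgebra.ι ℂ α * ExteriorAlgebra.ι ℂ β : FormAlg) =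
      ExteriorAlgebra.ιMulti ℂ 2 ![α, β] := by
    simp [ExteriorAlgebra.ιMulti_apply]
  rw [h]
  exact ExteriorAlgebra.ιMulti_range ℂ 2 ⟨_, rfl⟩

theorem extForm_two_apply (α β : C5 →L[ℝ] ℂ) (v : Fin 2 → C5) :
    extForm 2 (ExteriorAlgebra.ι ℂ α * ExteriorAlgebra.ι ℂ β) v =
      α (v 0) * β (v 1) - α (v 1) * β (v 0) := by
  have h : (ExteriorAlgebra.ι ℂ α * ExteriorAlgebra.ι ℂ β : FormAlg) =
      ExteriorAlgebra.ιMulti ℂ 2 ![α, β] := by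
    simp [ExteriorAlgebra.ιMulti_apply]
  rw [h, extForm_ιMulti, detForm_apply, Matrix.det_fin_two]
  simp

theorem stdForm_mem : stdForm ∈ ⋀[ℂ]^2 (C5 →L[ℝ] ℂ) :=
  Submodule.smul_mem _ _ (Submodule.sum_mem _ fun _ _ => ι_mul_ι_mem _ _)

variable {S : StructureConstants} (Γ : Subgroup (NilGroup S)) [DiscreteTopology Γ]

theorem wedge_invForm_ι (α β : C5 →L[ℝ] ℂ) :
    wedge (invForm Γ (extForm 1 (ExteriorAlgebra.ι ℂ α)))
      (invForm Γ (extForm 1 (ExteriorAlgebra.ι ℂ β))) =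
    invForm Γ (extForm 2 (ExteriorAlgebra.ι ℂ α * ExteriorAlgebra.ι ℂ β)) := by
  have h1 (γ : C5 →L[ℝ] ℂ) : ExteriorAlgebra.ι ℂ γ ∈ ⋀[ℂ]^1 (C5 →L[ℝ] ℂ) := by
    rw [ExteriorAlgebra.exteriorPower, pow_one]
    exact ⟨γ, rfl⟩
  rw [wedge_invForm, ← extForm_mul (h1 α) (h1 β)]

theorem wedge_etaForm_etaForm (j k : Fin 5) :
    wedge (etaForm Γ j) (etaForm Γ k) = invForm Γ (extForm 2 (zeta j * zeta k)) := by
  rw [etaForm_eq, etaForm_eq, wedge_invForm_ι]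
  rfl

theorem wedge_etaForm_etaBar (j k : Fin 5) :
    wedge (etaForm Γ j) (etaBar Γ k) = invForm Γ (extForm 2 (zeta j * zetaBar k)) := by
  rw [etaForm_eq, etaBar_eq, wedge_invForm_ι]
  rfl

/-- The invariant form of degree `k` defined by an element of the exterior algebra. -/
def invExt (k : ℕ) : FormAlg →ₗ[ℂ] Form C5 (Nilmanifold Γ) k := invFormLinear Γ k ∘ₗ extForm k

theorem invExt_apply (k : ℕ) (a : FormAlg) : invExt Γ k a = invForm Γ (extForm k a) := rfl

theorem diagonalForm_eq : diagonalForm Γ = invExt Γ 2 stdForm := by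
  rw [stdForm, map_smul, map_sum, diagonalForm]
  simp only [wedge_etaForm_etaBar]
  rfl

theorem wedgePow_invExt {a : FormAlg} (ha : a ∈ ⋀[ℂ]^2 (C5 →L[ℝ] ℂ)) (m : ℕ) :
    wedgePow (invExt Γ 2 a) m = invExt Γ (2 * m) (a ^ m) := by
  induction m with
  | zero =>
    funext x
    rw [pow_zero, invExt_apply]
    change _ = (extForm 0 (1 : FormAlg)).compContinuousLinearMap (coframe Γ x)
    rw [extForm_zero_one]
    rfl
  | succ m ih =>
    have hm : a ^ m ∈ ⋀[ℂ]^(2 * m) (C5 →L[ℝ] ℂ) := by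
      rw [ExteriorAlgebra.exteriorPower, pow_mul]
      exact Submodule.pow_mem_pow _ ha m
    rw [wedgePow, ih, invExt_apply, invExt_apply, wedge_invForm, ← extForm_mul hm ha, pow_succ]
    rfl

/-! ### The Hermitian metric -/

theorem diagonalMetric_apply (x : Nilmanifold Γ) (X Y : TangentSpace 𝓘(ℝ, C5) x) :
    diagonalMetric Γ x X Y = ∑ h : Fin 5, (eta Γ h x X * conj (eta Γ h x Y)).re := by
  simp [diagonalMetric, Complex.inner, mul_comm]

theorem isFundamentalForm_diagonalForm :
    IsFundamentalForm (complexStructure Γ) (diagonalMetric Γ) (diagonalForm Γ) := by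
  intro x X Y
  have h : diagonalForm Γ x ![X, Y] = (Complex.I / 2) * ∑ h : Fin 5,
      (eta Γ h x X * conj (eta Γ h x Y) - eta Γ h x Y * conj (eta Γ h x X)) := by
    rw [diagonalForm_eq, invExt_apply]
    change extForm 2 stdForm (fun i => coframe Γ x (![X, Y] i)) = _
    simp only [stdForm, map_smul, map_sum, ContinuousAlternatingMap.smul_apply,
      ContinuousAlternatingMap.sum_apply, zeta, zetaBar, extForm_two_apply, smul_eq_mul]
    rfl
  rw [h, diagonalMetric_apply, Finset.mul_sum]
  push_cast
  refine Finset.sum_congr rfl fun j _ => ?_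
  rw [eta_complexStructure]
  apply Complex.ext <;> simp <;> ring

/-- The metric and J determine the fundamental form, so the existential in the astheno-Kähler
condition has only one candidate. -/
theorem eq_diagonalForm {F : Form C5 (Nilmanifold Γ) 2}
    (hF : IsFundamentalForm (complexStructure Γ) (diagonalMetric Γ) F) : F = diagonalForm Γ := by
  funext x
  ext v
  have hv : v = ![v 0, v 1] := by
    funext i
    fin_cases i <;> rfl
  rw [hv, hF, isFundamentalForm_diagonalForm]

theorem isHermitianMetric_diagonalMetric :
    IsHermitianMetric (complexStructure Γ) (diagonalMetric Γ) where
  sq_eq := complexStructure_sq Γ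
  symm x X Y := by
    simp only [diagonalMetric_apply]
    refine Finset.sum_congr rfl fun h _ => ?_
    simp [mul_comm]
  pos x X hX := by
    have hne : coframe Γ x X ≠ 0 := fun h => hX (coframe_injective Γ x (h.trans (map_zero _).symm))
    obtain ⟨j, hj⟩ := Function.ne_iff.1 hne
    rw [diagonalMetric_apply]
    have hn (h : Fin 5) : (eta Γ h x X * conj (eta Γ h x X)).re =
        Complex.normSq (eta Γ h x X) := by
      rw [Complex.mul_conj, Complex.ofReal_re]
    simp only [hn]
    exact Finset.sum_pos' (fun h _ => Complex.normSq_nonneg _)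
      ⟨j, Finset.mem_univ _, Complex.normSq_pos.2 hj⟩
  isometry x X Y := by
    simp only [diagonalMetric_apply, eta_complexStructure]
    refine Finset.sum_congr rfl fun h _ => ?_
    simp
  smooth p a b := by
    have h (u : C5) (w : C5) (j : Fin 5) : eta Γ j ((chartAt C5 p).symm u)
        (mfderiv 𝓘(ℝ, C5) 𝓘(ℝ, C5) (chartAt C5 p).symm u w) = S.frame u w j := by
      have h1 := mfderiv_chartAt_symm Γ p u
      have h2 := congrArg (fun L : C5 →L[ℝ] C5 => L w j) (coframe_proj Γ u)
      rw [chartAt_symm]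
      refine Eq.trans ?_ h2
      exact congrArg (fun L : C5 →L[ℝ] C5 => (coframe Γ (proj Γ u) : C5 →L[ℝ] C5) (L w) j) h1
    simp only [diagonalMetric_apply, h]
    apply ContDiff.contDiffOn
    have hs (w : C5) (j : Fin 5) : ContDiff ℝ ∞ fun u => S.frame u w j :=
      (contDiff_apply ℝ ℂ j).comp (S.contDiff_frame.clm_apply contDiff_const)
    exact ContDiff.sum fun j _ => Complex.reCLM.contDiff.comp
      ((hs a j).mul (Complex.conjCLE.contDiff.comp (hs b j)))

/-! ### Types of forms -/

/-- The rotation by the angle `θ`. -/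
def rotation (θ : ℝ) : C5 →L[ℝ] C5 :=
  Real.cos θ • ContinuousLinearMap.id ℝ C5 + Real.sin θ • mulI

/-- `a` is a combination of forms of type `(p, q)` with `p - q = r`. -/
def HasWeight (r : ℤ) (a : FormAlg) : Prop :=
  ∀ θ : ℝ, ExteriorAlgebra.map (pullbackOne (rotation θ)) a =
    Complex.exp (r * θ * Complex.I) • a

theorem hasWeight_zeta (j : Fin 5) : HasWeight 1 (zeta j) := by
  intro θ
  rw [zeta, ExteriorAlgebra.map_apply_ι, ← map_smul]
  congr 1
  ext z
  simp [rotation, mulI, Complex.exp_mul_I]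
  ring

theorem hasWeight_zetaBar (j : Fin 5) : HasWeight (-1) (zetaBar j) := by
  intro θ
  rw [zetaBar, ExteriorAlgebra.map_apply_ι, ← map_smul]
  congr 1
  ext z
  have h : Complex.exp (-(θ * Complex.I)) = Complex.cos θ - Complex.sin θ * Complex.I := by
    rw [← neg_mul, Complex.exp_mul_I, Complex.cos_neg, Complex.sin_neg]
    ring
  simp [rotation, mulI, h]
  ring

theorem HasWeight.mul {r s : ℤ} {a b : FormAlg} (ha : HasWeight r a) (hb : HasWeight s b) :
    HasWeight (r + s) (a * b) := by
  intro θ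
  rw [map_mul, ha θ, hb θ, smul_mul_smul_comm, ← Complex.exp_add]
  congr 2
  push_cast
  ring

theorem HasWeight.add {r : ℤ} {a b : FormAlg} (ha : HasWeight r a) (hb : HasWeight r b) :
    HasWeight r (a + b) := fun θ => by rw [map_add, ha θ, hb θ, smul_add]

theorem HasWeight.smul {r : ℤ} {a : FormAlg} (c : ℂ) (ha : HasWeight r a) :
    HasWeight r (c • a) := fun θ => by rw [map_smul, ha θ, smul_comm]

theorem HasWeight.sub {r : ℤ} {a b : FormAlg} (ha : HasWeight r a) (hb : HasWeight r b) :
    HasWeight r (a - b) := fun θ => by rw [map_sub, ha θ, hb θ, smul_sub]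

theorem HasWeight.sum {r : ℤ} {ι : Type*} {s : Finset ι} {f : ι → FormAlg}
    (hf : ∀ i ∈ s, HasWeight r (f i)) : HasWeight r (∑ i ∈ s, f i) := fun θ => by
  rw [map_sum, Finset.smul_sum]
  exact Finset.sum_congr rfl fun i hi => hf i hi θ

theorem HasWeight.pow_of_zero {a : FormAlg} (ha : HasWeight 0 a) (n : ℕ) :
    HasWeight 0 (a ^ n) := fun θ => by
  have h := ha θ
  simp only [Int.cast_zero, zero_mul, Complex.exp_zero, one_smul] at h ⊢
  rw [map_pow, h]

theorem HasWeight.extForm_comp {r : ℤ} {a : FormAlg} (ha : HasWeight r a) (k : ℕ) (θ : ℝ) :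
    (extForm k a).compContinuousLinearMap (rotation θ) =
      Complex.exp (r * θ * Complex.I) • extForm k a := by
  rw [← extForm_map_pullbackOne, ha θ, map_smul]

theorem rotation_pi_div_two : rotation (Real.pi / 2) = mulI := by
  ext1 z
  simp [rotation]

theorem rotation_neg_pi_div_two : rotation (-(Real.pi / 2)) = -mulI := by
  ext1 z
  simp [rotation]

/-- Every rotation acts on an element of pure weight by a scalar, so the average is a geometric sum
in one root of unity. -/
theorem HasWeight.typeProjAlt_eq {r : ℤ} {a : FormAlg} (ha : HasWeight r a) {p q k : ℕ}
    (hk : p + q = k) :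
    typeProjAlt mulI p q (extForm k a) = ((2 * k + 1 : ℂ)⁻¹ *
      ∑ m ∈ Finset.range (2 * k + 1),
        Complex.exp (2 * Real.pi * Complex.I * (r - (p - q)) / (2 * k + 1)) ^ m) • extForm k a := by
  ext v
  simp only [typeProjAlt, if_pos hk, ContinuousAlternatingMap.smul_apply,
    ContinuousAlternatingMap.sum_apply, smul_eq_mul, mul_assoc, Finset.sum_mul]
  congr 1
  refine Finset.sum_congr rfl fun m _ => ?_
  have h := congrArg (fun f => f v) (ha.extForm_comp k (angle k m))
  simp only [ContinuousAlternatingMap.smul_apply, smul_eq_mul] at h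
  refine (congrArg (Complex.exp _ * ·) h).trans ?_
  rw [← mul_assoc, ← Complex.exp_add, ← Complex.exp_nat_mul]
  congr 2
  simp only [angle]
  push_cast
  ring

theorem HasWeight.typeProjAlt_self {r : ℤ} {a : FormAlg} (ha : HasWeight r a) {p q k : ℕ}
    (hk : p + q = k) (hr : r = p - q) : typeProjAlt mulI p q (extForm k a) = extForm k a := by
  rw [ha.typeProjAlt_eq hk, hr]
  have h : (2 * k + 1 : ℂ) ≠ 0 := by exact_mod_cast (2 * k).succ_ne_zero
  simp [h]

theorem HasWeight.typeProjAlt_of_ne {r : ℤ} {a : FormAlg} (ha : HasWeight r a) {p q k : ℕ}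
    (hk : p + q = k) (hr : r ≠ p - q) (hle : |r - (p - q)| ≤ 2 * k) :
    typeProjAlt mulI p q (extForm k a) = 0 := by
  rw [ha.typeProjAlt_eq hk]
  have hN : (2 * k + 1 : ℂ) ≠ 0 := by exact_mod_cast (2 * k).succ_ne_zero
  set ζ := Complex.exp (2 * Real.pi * Complex.I * (r - (p - q)) / (2 * k + 1)) with hζ
  have h1 : ζ ^ (2 * k + 1) = 1 := by
    rw [hζ, ← Complex.exp_nat_mul, Complex.exp_eq_one_iff]
    refine ⟨r - (p - q), ?_⟩
    push_cast
    field_simp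
  have h2 : ζ ≠ 1 := by
    intro h
    rw [hζ, Complex.exp_eq_one_iff] at h
    obtain ⟨n, hn⟩ := h
    have hpi : (2 * Real.pi * Complex.I : ℂ) ≠ 0 := Complex.two_pi_I_ne_zero
    have hn' : ((r - (p - q) : ℤ) : ℂ) = ((n * (2 * k + 1) : ℤ) : ℂ) := by
      push_cast
      rw [div_eq_iff hN] at hn
      apply mul_left_cancel₀ hpi
      rw [hn]
      ring
    have hn'' : r - (p - q) = n * (2 * k + 1) := by exact_mod_cast hn'
    have hn0 : n ≠ 0 := by
      rintro rfl
      apply hr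
      linarith
    -- If ζ were 1, then 2k + 1 would divide the nonzero integer r - (p - q), against the bound 2k
    -- on its absolute value.
    have h3 : (2 * k + 1 : ℤ) ≤ |r - (p - q)| := by
      rw [hn'', abs_mul, abs_of_nonneg (by positivity : (0 : ℤ) ≤ 2 * k + 1)]
      have := Int.one_le_abs hn0
      nlinarith
    linarith
  have h3 : ∑ m ∈ Finset.range (2 * k + 1), ζ ^ m = 0 := by
    rw [geom_sum_eq h2, h1, sub_self, zero_div]
  rw [h3, mul_zero]
  ext v
  simp

end Nilmanifold

namespace Nilmanifold

/-! ### The exterior derivative on invariant forms -/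

/-- The coefficient of `dz_5` in a linear form. -/
def lastCoeff : Module.Dual ℂ (C5 →L[ℝ] ℂ) where
  toFun α := (α (Pi.single 4 1) - Complex.I * α (Pi.single 4 Complex.I)) / 2
  map_add' α β := by simp; ring
  map_smul' c α := by simp; ring

/-- The coefficient of `conj dz_5` in a linear form. -/
def lastCoeffBar : Module.Dual ℂ (C5 →L[ℝ] ℂ) where
  toFun α := (α (Pi.single 4 1) + Complex.I * α (Pi.single 4 Complex.I)) / 2
  map_add' α β := by simp; ring
  map_smul' c α := by simp; ring

theorem lastCoeff_apply (α : C5 →L[ℝ] ℂ) : lastCoeff α =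
    (α (Pi.single 4 1) - Complex.I * α (Pi.single 4 Complex.I)) / 2 := rfl

theorem lastCoeffBar_apply (α : C5 →L[ℝ] ℂ) : lastCoeffBar α =
    (α (Pi.single 4 1) + Complex.I * α (Pi.single 4 Complex.I)) / 2 := rfl

/-- A real-linear map from ℂ to ℂ is the sum of its complex-linear and antilinear parts. -/
theorem apply_single_four (α : C5 →L[ℝ] ℂ) (w : ℂ) :
    α (Pi.single 4 w) = lastCoeff α * w + lastCoeffBar α * conj w := by
  have h : (Pi.single 4 w : C5) = w.re • (Pi.single 4 1 : C5) +
      w.im • (Pi.single 4 Complex.I : C5) := by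
    rw [← Pi.single_smul, ← Pi.single_smul, ← Pi.single_add]
    congr 1
    apply Complex.ext <;> simp
  rw [h, map_add, map_smul, map_smul, lastCoeff_apply, lastCoeffBar_apply]
  have h1 : w = w.re + w.im * Complex.I := (Complex.re_add_im w).symm
  have h2 : conj w = w.re - w.im * Complex.I := by
    apply Complex.ext <;> simp
  rw [h2]
  -- Only the bare factor w is to be expanded; the occurrences inside real and imaginary parts must
  -- stay.
  nth_rewrite 3 [h1]
  simp only [Complex.real_smul]
  linear_combination (w.im : ℂ) * α (Pi.single 4 Complex.I) * Complex.I_sq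

theorem lastCoeff_dz (j : Fin 5) : lastCoeff (dz j) = if j = 4 then 1 else 0 := by
  by_cases h : j = 4
  · subst h
    simp [lastCoeff_apply]
  · simp [lastCoeff_apply, h]

theorem lastCoeff_dzBar (j : Fin 5) : lastCoeff (dzBar j) = 0 := by
  by_cases h : j = 4
  · subst h
    simp [lastCoeff_apply]
  · simp [lastCoeff_apply, h]

theorem lastCoeffBar_dz (j : Fin 5) : lastCoeffBar (dz j) = 0 := by
  by_cases h : j = 4
  · subst h
    simp [lastCoeffBar_apply]
  · simp [lastCoeffBar_apply, h]

theorem lastCoeffBar_dzBar (j : Fin 5) : lastCoeffBar (dzBar j) = if j = 4 then 1 else 0 := by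
  by_cases h : j = 4
  · subst h
    simp [lastCoeffBar_apply]
  · simp [lastCoeffBar_apply, h]

/-- The interior product with `∂₅`. -/
def contr : FormAlg →ₗ[ℂ] FormAlg :=
  CliffordAlgebra.contractLeft (Q := (0 : QuadraticForm ℂ (C5 →L[ℝ] ℂ))) lastCoeff

/-- The interior product with `∂̄₅`. -/
def contrBar : FormAlg →ₗ[ℂ] FormAlg :=
  CliffordAlgebra.contractLeft (Q := (0 : QuadraticForm ℂ (C5 →L[ℝ] ℂ))) lastCoeffBar

theorem contr_ι_mul (α : C5 →L[ℝ] ℂ) (b : FormAlg) :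
    contr (ExteriorAlgebra.ι ℂ α * b) = lastCoeff α • b - ExteriorAlgebra.ι ℂ α * contr b :=
  CliffordAlgebra.contractLeft_ι_mul _ _ _

theorem contrBar_ι_mul (α : C5 →L[ℝ] ℂ) (b : FormAlg) :
    contrBar (ExteriorAlgebra.ι ℂ α * b) =
      lastCoeffBar α • b - ExteriorAlgebra.ι ℂ α * contrBar b :=
  CliffordAlgebra.contractLeft_ι_mul _ _ _

theorem contr_one : contr 1 = 0 := CliffordAlgebra.contractLeft_one _ _

theorem contrBar_one : contrBar 1 = 0 := CliffordAlgebra.contractLeft_one _ _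

/-- The even elements of the exterior algebra that do not involve `dz_5` and `conj dz_5`:
they are central, and the interior products with `∂₅` and `∂̄₅` commute with
multiplication by them. -/
def basic : Subalgebra ℂ FormAlg where
  carrier := {a | (∀ b, a * b = b * a) ∧ (∀ b, contr (a * b) = a * contr b) ∧
    ∀ b, contrBar (a * b) = a * contrBar b}
  mul_mem' := by
    rintro a a' ⟨h1, h2, h3⟩ ⟨h1', h2', h3'⟩
    refine ⟨fun b => ?_, fun b => ?_, fun b => ?_⟩
    · rw [mul_assoc, h1', h1, mul_assoc, h1 a']
    · rw [mul_assoc, h2, h2', mul_assoc]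
    · rw [mul_assoc, h3, h3', mul_assoc]
  add_mem' := by
    rintro a a' ⟨h1, h2, h3⟩ ⟨h1', h2', h3'⟩
    refine ⟨fun b => ?_, fun b => ?_, fun b => ?_⟩
    · rw [add_mul, h1, h1', mul_add]
    · rw [add_mul, map_add, h2, h2', add_mul]
    · rw [add_mul, map_add, h3, h3', add_mul]
  algebraMap_mem' c := by
    refine ⟨fun b => Algebra.commutes c b, fun b => ?_, fun b => ?_⟩
    · rw [← Algebra.smul_def, map_smul, Algebra.smul_def]
    · rw [← Algebra.smul_def, map_smul, Algebra.smul_def]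

/-- Commutativity lets `ring` and `linear_combination` handle all later products of horizontal
2-forms. -/
instance : CommRing basic :=
  { (inferInstance : Ring basic) with mul_comm := fun a b => Subtype.ext (a.2.1 b) }

theorem ι_mul_ι_swap (α β : C5 →L[ℝ] ℂ) :
    (ExteriorAlgebra.ι ℂ α * ExteriorAlgebra.ι ℂ β : FormAlg) =
      -(ExteriorAlgebra.ι ℂ β * ExteriorAlgebra.ι ℂ α) :=
  eq_neg_of_add_eq_zero_left (ExteriorAlgebra.ι_add_mul_swap α β)

/-- A generator passes two factors at the cost of two signs, which cancel. -/
theorem ι_mul_ι_comm (α β : C5 →L[ℝ] ℂ) (b : FormAlg) :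
    ExteriorAlgebra.ι ℂ α * ExteriorAlgebra.ι ℂ β * b =
      b * (ExteriorAlgebra.ι ℂ α * ExteriorAlgebra.ι ℂ β) := by
  induction b using ExteriorAlgebra.induction with
  | algebraMap c => exact (Algebra.commutes c _).symm
  | ι γ =>
    rw [mul_assoc, ι_mul_ι_swap β γ, mul_neg, ← mul_assoc, ι_mul_ι_swap α γ, neg_mul, neg_neg,
      mul_assoc]
  | mul a b ha hb => rw [← mul_assoc, ha, mul_assoc, hb, mul_assoc]
  | add a b ha hb => rw [mul_add, add_mul, ha, hb]

/-- Linear forms without `dz_5` and `conj dz_5`. -/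
def IsHorizontal (α : C5 →L[ℝ] ℂ) : Prop := lastCoeff α = 0 ∧ lastCoeffBar α = 0

theorem castSucc_ne_four (j : Fin 4) : j.castSucc ≠ 4 := (Fin.castSucc_lt_last j).ne

theorem isHorizontal_dz (j : Fin 4) : IsHorizontal (dz j.castSucc) := by
  refine ⟨?_, lastCoeffBar_dz _⟩
  rw [lastCoeff_dz, if_neg (castSucc_ne_four j)]

theorem isHorizontal_dzBar (j : Fin 4) : IsHorizontal (dzBar j.castSucc) := by
  refine ⟨lastCoeff_dzBar _, ?_⟩
  rw [lastCoeffBar_dzBar, if_neg (castSucc_ne_four j)]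

theorem ι_mul_ι_mem_basic {α β : C5 →L[ℝ] ℂ} (hα : IsHorizontal α) (hβ : IsHorizontal β) :
    (ExteriorAlgebra.ι ℂ α * ExteriorAlgebra.ι ℂ β : FormAlg) ∈ basic := by
  refine ⟨ι_mul_ι_comm α β, fun b => ?_, fun b => ?_⟩
  · rw [mul_assoc, contr_ι_mul, contr_ι_mul, hα.1, hβ.1, zero_smul, zero_smul]
    noncomm_ring
  · rw [mul_assoc, contrBar_ι_mul, contrBar_ι_mul, hα.2, hβ.2, zero_smul, zero_smul]
    noncomm_ring

/-- `dz_j ∧ dz_k` for `j, k ≤ 4`. -/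
def hol (j k : Fin 4) : basic := ⟨_, ι_mul_ι_mem_basic (isHorizontal_dz j) (isHorizontal_dz k)⟩

/-- `conj dz_j ∧ conj dz_k` for `j, k ≤ 4`. -/
def antihol (j k : Fin 4) : basic :=
  ⟨_, ι_mul_ι_mem_basic (isHorizontal_dzBar j) (isHorizontal_dzBar k)⟩

/-- `dz_j ∧ conj dz_k` for `j, k ≤ 4`. -/
def mix (j k : Fin 4) : basic := ⟨_, ι_mul_ι_mem_basic (isHorizontal_dz j) (isHorizontal_dzBar k)⟩

/-- `∑ dz_j ∧ conj dz_j` over `j ≤ 4`. -/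
def trace : basic := ∑ j : Fin 4, mix j j

end Nilmanifold

namespace StructureConstants

variable (S : StructureConstants)

/-- The `(2, 0)`-part of `d η^5`. -/
def omegaHol : basic := ∑ j, ∑ k, S.coeffHol j k • hol j k

/-- The `(1, 1)`-part of `d η^5`. -/
def omegaMix : basic := ∑ j, ∑ k, S.coeffMix j k • mix j k

/-- The conjugate of the `(2, 0)`-part of `d η^5`. -/
def omegaHolBar : basic := ∑ j, ∑ k, conj (S.coeffHol j k) • antihol j k

/-- The conjugate of the `(1, 1)`-part of `d η^5`. -/
def omegaMixBar : basic := -∑ j, ∑ k, conj (S.coeffMix j k) • mix k j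

/-- The exterior derivative of invariant forms. -/
def diff (a : FormAlg) : FormAlg :=
  (S.omegaHol + S.omegaMix : basic) * contr a +
    (S.omegaHolBar + S.omegaMixBar : basic) * contrBar a

/-- A linear form α composed with the shear sees only the coefficients of dz_5 and of its conjugate
in α, multiplied by B and by conj B. Expanding B into monomials gives the rank one terms required by
`leibniz_extForm`. -/
theorem leibniz_shear_extForm (k : ℕ) (a : FormAlg) :
    leibniz S.shear (extForm k a) = extForm (k + 1) (S.diff a) := by
  -- The pair (j, k) selects a monomial of B. The first flag separates the terms from η^{jk} and
  -- from η^{j k̄}; the second separates B, paired with ∂₅, from its conjugate, paired with ∂̄₅.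
  let l : (Fin 4 × Fin 4) × Bool × Bool → Module.Dual ℂ (C5 →L[ℝ] ℂ)
    | (_, _, false) => lastCoeff
    | (_, _, true) => lastCoeffBar
  let φ : (Fin 4 × Fin 4) × Bool × Bool → C5 →L[ℝ] ℂ
    | ((j, k), false, false) => S.coeffHol j k • dz j.castSucc
    | ((j, k), true, false) => S.coeffMix j k • dz j.castSucc
    | ((j, k), false, true) => conj (S.coeffHol j k) • dzBar j.castSucc
    | ((j, k), true, true) => conj (S.coeffMix j k) • dzBar j.castSucc
  let ψ : (Fin 4 × Fin 4) × Bool × Bool → C5 →L[ℝ] ℂ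
    | ((_, k), false, false) => dz k.castSucc
    | ((_, k), true, false) => dzBar k.castSucc
    | ((_, k), false, true) => dzBar k.castSucc
    | ((_, k), true, true) => dz k.castSucc
  rw [leibniz_extForm S.shear l φ ψ ?_ k a]
  · congr 1
    simp only [Fintype.sum_prod_type, Fintype.sum_bool, l, φ, ψ, map_smul, smul_mul_assoc]
    change ∑ j : Fin 4, ∑ k : Fin 4, _ = _
    simp only [diff, omegaHol, omegaMix, omegaHolBar, omegaMixBar, AddMemClass.coe_add,
      NegMemClass.coe_neg, AddSubmonoidClass.coe_finsetSum, Subalgebra.coe_smul, add_mul,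
      neg_mul, Finset.sum_mul, smul_mul_assoc, ← Finset.sum_neg_distrib,
      ← Finset.sum_add_distrib]
    refine Finset.sum_congr rfl fun j _ => Finset.sum_congr rfl fun k _ => ?_
    have h1 : (hol j k : FormAlg) = ExteriorAlgebra.ι ℂ (dz j.castSucc) *
      ExteriorAlgebra.ι ℂ (dz k.castSucc) := rfl
    have h2 : (mix j k : FormAlg) = ExteriorAlgebra.ι ℂ (dz j.castSucc) *
      ExteriorAlgebra.ι ℂ (dzBar k.castSucc) := rfl
    have h3 : (antihol j k : FormAlg) = ExteriorAlgebra.ι ℂ (dzBar j.castSucc) *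
      ExteriorAlgebra.ι ℂ (dzBar k.castSucc) := rfl
    have h4 : (mix k j : FormAlg) = -(ExteriorAlgebra.ι ℂ (dzBar j.castSucc) *
      ExteriorAlgebra.ι ℂ (dz k.castSucc)) := ι_mul_ι_swap _ _
    rw [h1, h2, h3, h4, neg_mul, smul_neg, neg_neg]
    have key (c₁ c₂ c₃ c₄ : ℂ) (x x' y y' p q : FormAlg) :
        c₁ • (y * (x' * q)) + c₂ • (x * (y' * p)) + (c₃ • (y * (y' * q)) + c₄ • (x * (x' * p))) =
          c₄ • (x * x' * p) + c₂ • (x * y' * p) + (c₃ • (y * y' * q) + c₁ • (y * x' * q)) := by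
      simp only [_root_.mul_assoc]
      abel
    exact key _ _ _ _ _ _ _ _ _ _
  · intro α u
    ext w
    simp only [Fintype.sum_prod_type, Fintype.sum_bool, l, φ, ψ]
    rw [ContinuousLinearMap.comp_apply, shear_apply, apply_single_four, ← bilCLM_apply,
      bilCLM_apply_eq_sum]
    simp only [map_sum, map_add, map_mul, Complex.conj_conj, Finset.mul_sum,
      ← Finset.sum_add_distrib, sum_apply, add_apply, smul_apply, dz_apply, dzBar_apply,
      smul_eq_mul]
    refine Finset.sum_congr rfl fun j _ => Finset.sum_congr rfl fun k _ => ?_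
    ring

end StructureConstants

/-! ### Powers of the fundamental form and their differentials. -/

namespace Nilmanifold

theorem stdForm_eq : stdForm = (Complex.I / 2) • ((trace : FormAlg) + zeta 4 * zetaBar 4) := by
  rw [stdForm, Fin.sum_univ_castSucc, trace, AddSubmonoidClass.coe_finsetSum]
  rfl

/-- The binomial expansion stops after the linear term in η^{5 5̄}, whose square vanishes. -/
theorem stdForm_pow (n : ℕ) : stdForm ^ (n + 1) = (Complex.I / 2) ^ (n + 1) •
    (((trace ^ (n + 1) : basic) : FormAlg) +
      ((n : ℂ) + 1) • (((trace ^ n : basic) : FormAlg) * (zeta 4 * zetaBar 4))) := by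
  have hw : zeta 4 * zetaBar 4 * (zeta 4 * zetaBar 4) = 0 := by
    rw [zeta, zetaBar, ← ι_mul_ι_comm, ← mul_assoc, mul_assoc _ (ExteriorAlgebra.ι ℂ (dzBar 4)),
      ι_mul_ι_swap (dzBar 4), mul_neg, ← mul_assoc, ExteriorAlgebra.ι_sq_zero, zero_mul, neg_zero,
      zero_mul]
  rw [stdForm_eq, smul_pow]
  congr 1
  induction n with
  | zero => simp
  | succ n ih =>
    rw [pow_succ, ih]
    have hc : zeta 4 * zetaBar 4 * (trace : FormAlg) = trace * (zeta 4 * zetaBar 4) :=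
      ι_mul_ι_comm _ _ _
    simp only [add_mul, mul_add, smul_mul_assoc, mul_assoc, hw, mul_zero, smul_zero, add_zero]
    rw [← mul_assoc (zeta 4), hc, ← mul_assoc _ (trace : FormAlg)]
    simp only [← MulMemClass.coe_mul, ← pow_succ]
    push_cast
    module

theorem contr_basic_mul (a : basic) (b : FormAlg) : contr (a * b) = a * contr b := a.2.2.1 b

theorem contrBar_basic_mul (a : basic) (b : FormAlg) : contrBar (a * b) = a * contrBar b :=
  a.2.2.2 b

theorem contr_basic (a : basic) : contr a = 0 := by
  simpa [contr_one] using contr_basic_mul a 1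

theorem contrBar_basic (a : basic) : contrBar a = 0 := by
  simpa [contrBar_one] using contrBar_basic_mul a 1

theorem contr_zeta : contr (zeta 4) = 1 := by
  simpa [zeta, contr_one, lastCoeff_dz] using contr_ι_mul (dz 4) 1

theorem contr_zetaBar : contr (zetaBar 4) = 0 := by
  simpa [zetaBar, contr_one, lastCoeff_dzBar] using contr_ι_mul (dzBar 4) 1

theorem contrBar_zeta : contrBar (zeta 4) = 0 := by
  simpa [zeta, contrBar_one, lastCoeffBar_dz] using contrBar_ι_mul (dz 4) 1

theorem contrBar_zetaBar : contrBar (zetaBar 4) = 1 := by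
  simpa [zetaBar, contrBar_one, lastCoeffBar_dzBar] using contrBar_ι_mul (dzBar 4) 1

theorem contr_zeta_mul_zetaBar : contr (zeta 4 * zetaBar 4) = zetaBar 4 := by
  have h := contr_ι_mul (dz 4) (zetaBar 4)
  rw [contr_zetaBar, mul_zero, sub_zero, lastCoeff_dz, if_pos rfl, one_smul] at h
  exact h

theorem contrBar_zeta_mul_zetaBar : contrBar (zeta 4 * zetaBar 4) = -zeta 4 := by
  have h := contrBar_ι_mul (dz 4) (zetaBar 4)
  rw [contrBar_zetaBar, mul_one, lastCoeffBar_dz, zero_smul, zero_sub] at h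
  exact h

end Nilmanifold

namespace StructureConstants

variable (S : StructureConstants)

theorem diff_add (a b : FormAlg) : S.diff (a + b) = S.diff a + S.diff b := by
  simp only [diff, map_add, mul_add]
  abel

theorem diff_sub (a b : FormAlg) : S.diff (a - b) = S.diff a - S.diff b := by
  simp only [diff, map_sub, mul_sub]
  abel

theorem diff_smul (c : ℂ) (a : FormAlg) : S.diff (c • a) = c • S.diff a := by
  simp only [diff, map_smul, mul_smul_comm, smul_add]

theorem diff_basic (a : basic) : S.diff a = 0 := by
  simp [diff, contr_basic, contrBar_basic]

theorem diff_basic_mul_zeta (a : basic) :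
    S.diff (a * zeta 4) = ((S.omegaHol + S.omegaMix) * a : basic) := by
  simp [diff, contr_basic_mul, contrBar_basic_mul, contr_zeta, contrBar_zeta]

theorem diff_basic_mul_zetaBar (a : basic) :
    S.diff (a * zetaBar 4) = ((S.omegaHolBar + S.omegaMixBar) * a : basic) := by
  simp [diff, contr_basic_mul, contrBar_basic_mul, contr_zetaBar, contrBar_zetaBar]

/-- The part of weight `1` of the differential of a power of the fundamental form. -/
def delPart (n : ℕ) : FormAlg :=
  (trace ^ n * S.omegaHol : basic) * zetaBar 4 - (trace ^ n * S.omegaMixBar : basic) * zeta 4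

/-- The part of weight `-1` of the differential of a power of the fundamental form. -/
def delbarPart (n : ℕ) : FormAlg :=
  (trace ^ n * S.omegaMix : basic) * zetaBar 4 - (trace ^ n * S.omegaHolBar : basic) * zeta 4

/-- The form `∂ ∂̄ (η^5 ∧ conj η^5)`. -/
def torsion : basic := S.omegaMix * S.omegaMixBar - S.omegaHol * S.omegaHolBar

/-- Powers of the trace are closed, so only the term with η^{5 5̄} contributes; the result is sorted
into the two possible types. -/
theorem diff_stdForm_pow (n : ℕ) : S.diff (stdForm ^ (n + 1)) =
    ((Complex.I / 2) ^ (n + 1) * (n + 1)) • (S.delPart n + S.delbarPart n) := by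
  have hT : S.diff (((trace ^ n : basic) : FormAlg) * (zeta 4 * zetaBar 4)) =
      S.delPart n + S.delbarPart n := by
    rw [diff, contr_basic_mul, contrBar_basic_mul, contr_zeta_mul_zetaBar,
      contrBar_zeta_mul_zetaBar]
    have h1 : ((S.omegaHol + S.omegaMix : basic) : FormAlg) * ((trace ^ n : basic) * zetaBar 4) =
        (trace ^ n * S.omegaHol + trace ^ n * S.omegaMix : basic) * zetaBar 4 := by
      rw [← _root_.mul_assoc, ← MulMemClass.coe_mul]
      congr 2
      ring
    have h2 : ((S.omegaHolBar + S.omegaMixBar : basic) : FormAlg) * ((trace ^ n : basic) *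
        -zeta 4) = -((trace ^ n * S.omegaHolBar + trace ^ n * S.omegaMixBar : basic) * zeta 4) := by
      rw [← _root_.mul_assoc, ← MulMemClass.coe_mul, mul_neg]
      congr 3
      ring
    rw [h1, h2, delPart, delbarPart, AddMemClass.coe_add, AddMemClass.coe_add, add_mul, add_mul]
    abel
  rw [stdForm_pow, diff_smul, diff_add, diff_smul, diff_basic, hT, zero_add, smul_smul]

theorem diff_delbarPart (n : ℕ) : S.diff (S.delbarPart n) = (trace ^ n * S.torsion : basic) := by
  rw [delbarPart, diff_sub, diff_basic_mul_zeta, diff_basic_mul_zetaBar,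
    ← AddSubgroupClass.coe_sub]
  congr 1
  rw [torsion]
  ring

/-- The sign is opposite to that in `diff_delbarPart`, in accordance with d² = 0 on powers of the
fundamental form. -/
theorem diff_delPart (n : ℕ) : S.diff (S.delPart n) = -(trace ^ n * S.torsion : basic) := by
  rw [delPart, diff_sub, diff_basic_mul_zeta, diff_basic_mul_zetaBar,
    ← AddSubgroupClass.coe_sub, ← NegMemClass.coe_neg]
  congr 1
  rw [torsion]
  ring

/-! ### Weights of the components of the differential. -/

theorem hasWeight_omegaHol : HasWeight 2 (S.omegaHol : FormAlg) := by
  rw [omegaHol, AddSubmonoidClass.coe_finsetSum]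
  refine HasWeight.sum fun j _ => ?_
  rw [AddSubmonoidClass.coe_finsetSum]
  exact HasWeight.sum fun k _ => ((hasWeight_zeta _).mul (hasWeight_zeta _)).smul _

theorem hasWeight_omegaMix : HasWeight 0 (S.omegaMix : FormAlg) := by
  rw [omegaMix, AddSubmonoidClass.coe_finsetSum]
  refine HasWeight.sum fun j _ => ?_
  rw [AddSubmonoidClass.coe_finsetSum]
  exact HasWeight.sum fun k _ => ((hasWeight_zeta _).mul (hasWeight_zetaBar _)).smul _

theorem hasWeight_omegaHolBar : HasWeight (-2) (S.omegaHolBar : FormAlg) := by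
  rw [omegaHolBar, AddSubmonoidClass.coe_finsetSum]
  refine HasWeight.sum fun j _ => ?_
  rw [AddSubmonoidClass.coe_finsetSum]
  exact HasWeight.sum fun k _ => ((hasWeight_zetaBar _).mul (hasWeight_zetaBar _)).smul _

theorem hasWeight_omegaMixBar : HasWeight 0 (S.omegaMixBar : FormAlg) := by
  rw [omegaMixBar, NegMemClass.coe_neg, AddSubmonoidClass.coe_finsetSum, ← neg_one_smul ℂ]
  refine HasWeight.smul _ (HasWeight.sum fun j _ => ?_)
  rw [AddSubmonoidClass.coe_finsetSum]
  exact HasWeight.sum fun k _ => ((hasWeight_zeta _).mul (hasWeight_zetaBar _)).smul _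

theorem hasWeight_trace : HasWeight 0 (trace : FormAlg) := by
  rw [trace, AddSubmonoidClass.coe_finsetSum]
  refine HasWeight.sum fun j _ => ?_
  have h := (hasWeight_zeta j.castSucc).mul (hasWeight_zetaBar j.castSucc)
  rwa [add_neg_cancel] at h

theorem hasWeight_trace_pow_mul {r : ℤ} {a : basic} (ha : HasWeight r (a : FormAlg)) (n : ℕ) :
    HasWeight r ((trace ^ n * a : basic) : FormAlg) := by
  induction n with
  | zero => rwa [pow_zero, one_mul]
  | succ n ih =>
    rw [pow_succ', _root_.mul_assoc, MulMemClass.coe_mul, ← zero_add r]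
    exact hasWeight_trace.mul ih

theorem hasWeight_delPart (n : ℕ) : HasWeight 1 (S.delPart n) := by
  have h1 := (hasWeight_trace_pow_mul S.hasWeight_omegaHol n).mul (hasWeight_zetaBar 4)
  have h2 := (hasWeight_trace_pow_mul S.hasWeight_omegaMixBar n).mul (hasWeight_zeta 4)
  rw [show (2 : ℤ) + -1 = 1 from rfl] at h1
  rw [zero_add] at h2
  exact h1.sub h2

theorem hasWeight_delbarPart (n : ℕ) : HasWeight (-1) (S.delbarPart n) := by
  have h1 := (hasWeight_trace_pow_mul S.hasWeight_omegaMix n).mul (hasWeight_zetaBar 4)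
  have h2 := (hasWeight_trace_pow_mul S.hasWeight_omegaHolBar n).mul (hasWeight_zeta 4)
  rw [zero_add] at h1
  rw [show (-2 : ℤ) + 1 = -1 from rfl] at h2
  exact h1.sub h2

theorem hasWeight_torsion : HasWeight 0 (S.torsion : FormAlg) := by
  have h1 := S.hasWeight_omegaMix.mul S.hasWeight_omegaMixBar
  have h2 := S.hasWeight_omegaHol.mul S.hasWeight_omegaHolBar
  rw [zero_add] at h1
  rw [show (2 : ℤ) + -2 = 0 from rfl] at h2
  rw [torsion, AddSubgroupClass.coe_sub, MulMemClass.coe_mul, MulMemClass.coe_mul]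
  exact h1.sub h2

theorem hasWeight_stdForm : HasWeight 0 stdForm :=
  (HasWeight.sum fun _ _ => (hasWeight_zeta _).mul (hasWeight_zetaBar _)).smul _

end StructureConstants

/-! ### The forms ∂∂̄Fⁿ and dd^cFⁿ on the nilmanifold. -/

namespace Nilmanifold

variable {S : StructureConstants} (Γ : Subgroup (NilGroup S)) [DiscreteTopology Γ]

theorem d_invExt (k : ℕ) (a : FormAlg) : d (invExt Γ k a) = invExt Γ (k + 1) (S.diff a) := by
  rw [invExt_apply, d_invForm, S.leibniz_shear_extForm, invExt_apply]

theorem typeProj_invExt_self {r : ℤ} {a : FormAlg} (ha : HasWeight r a) {p q k : ℕ}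
    (hk : p + q = k) (hr : r = p - q) :
    typeProj (complexStructure Γ) p q (invExt Γ k a) = invExt Γ k a := by
  rw [invExt_apply, typeProj_invForm, ha.typeProjAlt_self hk hr]

theorem typeProjAlt_add {k : ℕ} (p q : ℕ) (A B : C5 [⋀^Fin k]→L[ℝ] ℂ) :
    typeProjAlt mulI p q (A + B) = typeProjAlt mulI p q A + typeProjAlt mulI p q B := by
  ext v
  by_cases h : p + q = k
  · simp [typeProjAlt, if_pos h, ContinuousAlternatingMap.sum_apply, Finset.sum_add_distrib,
      mul_add]
  · simp [typeProjAlt, if_neg h]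

theorem typeProj_invExt_add {r s : ℤ} {a b : FormAlg} (ha : HasWeight r a) (hb : HasWeight s b)
    {p q k : ℕ} (hk : p + q = k) (hr : r ≠ p - q) (hle : |r - (p - q)| ≤ 2 * k)
    (hs : s = p - q) :
    typeProj (complexStructure Γ) p q (invExt Γ k (a + b)) = invExt Γ k b := by
  rw [invExt_apply, typeProj_invForm, map_add, typeProjAlt_add, ha.typeProjAlt_of_ne hk hr hle,
    hb.typeProjAlt_self hk hs, zero_add, invExt_apply]

/-- The coefficient of `∂ ∂̄ F^n`. -/
def powCoeff (n : ℕ) : ℂ := (Complex.I / 2) ^ (n + 1) * (n + 1)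

theorem powCoeff_ne_zero (n : ℕ) : powCoeff n ≠ 0 :=
  mul_ne_zero (pow_ne_zero _ (div_ne_zero Complex.I_ne_zero two_ne_zero))
    (by exact_mod_cast n.succ_ne_zero)

/-- The projection in ∂̄ keeps the part of weight -1 of the differential. The differential of that
part already has weight 0, so the projection in ∂ changes nothing. -/
theorem del_delbar_wedgePow (n : ℕ) :
    del (complexStructure Γ) (n + 1) (n + 1 + 1) (delbar (complexStructure Γ) (n + 1) (n + 1)
      (wedgePow (diagonalForm Γ) (n + 1))) =
    powCoeff n • invExt Γ (2 * (n + 1) + 1 + 1) ((trace ^ n * S.torsion : basic) : FormAlg) := by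
  rw [diagonalForm_eq, wedgePow_invExt Γ stdForm_mem, delbar, d_invExt, S.diff_stdForm_pow,
    smul_add, typeProj_invExt_add Γ ((S.hasWeight_delPart n).smul _)
      ((S.hasWeight_delbarPart n).smul _) (by ring) (by push_cast; omega) ?_
      (by push_cast; ring), del, d_invExt, S.diff_smul, S.diff_delbarPart,
    typeProj_invExt_self Γ
      ((StructureConstants.hasWeight_trace_pow_mul S.hasWeight_torsion n).smul _) (by ring)
      (by push_cast; ring), map_smul]
  · rfl
  · push_cast
    rw [abs_le]
    constructor <;> linarith

/-- J fixes the powers of F, and J⁻¹, the rotation by -π/2, multiplies weights 1 and -1 by -i and i.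
The two parts have opposite differentials, so their contributions add up and produce the factor 2i.
-/
theorem d_dc_wedgePow (n : ℕ) :
    d (dc (complexStructure Γ) (wedgePow (diagonalForm Γ) (n + 1))) =
    (2 * Complex.I * powCoeff n) •
      invExt Γ (2 * (n + 1) + 1 + 1) ((trace ^ n * S.torsion : basic) : FormAlg) := by
  have h0 : HasWeight 0 (stdForm ^ (n + 1)) :=
    StructureConstants.hasWeight_stdForm.pow_of_zero _
  have he : Complex.exp (-(Real.pi / 2 * Complex.I)) = -Complex.I := by
    rw [Complex.exp_neg, Complex.exp_pi_div_two_mul_I, Complex.inv_I]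
  have h1 : (extForm (2 * (n + 1) + 1) (S.delPart n)).compContinuousLinearMap (-mulI) =
      extForm (2 * (n + 1) + 1) (-Complex.I • S.delPart n) := by
    rw [← rotation_neg_pi_div_two, (S.hasWeight_delPart n).extForm_comp, map_smul]
    congr 1
    rw [← he]
    push_cast
    congr 1
    ring
  have h2 : (extForm (2 * (n + 1) + 1) (S.delbarPart n)).compContinuousLinearMap (-mulI) =
      extForm (2 * (n + 1) + 1) (Complex.I • S.delbarPart n) := by
    rw [← rotation_neg_pi_div_two, (S.hasWeight_delbarPart n).extForm_comp, map_smul]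
    congr 1
    refine Eq.trans (congrArg Complex.exp ?_) Complex.exp_pi_div_two_mul_I
    push_cast
    ring
  have h3 (c : ℂ) : (extForm (2 * (n + 1) + 1)
      (c • (S.delPart n + S.delbarPart n))).compContinuousLinearMap (-mulI) =
      extForm (2 * (n + 1) + 1)
        (c • (-Complex.I • S.delPart n + Complex.I • S.delbarPart n)) := by
    rw [map_smul, map_smul, map_add, map_add, ← h1, ← h2]
    rfl
  rw [diagonalForm_eq, wedgePow_invExt Γ stdForm_mem, invExt_apply, dc_invForm,
    ← rotation_pi_div_two, h0.extForm_comp, Int.cast_zero, zero_mul, zero_mul, Complex.exp_zero,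
    ← map_smul, one_smul, S.leibniz_shear_extForm, rotation_pi_div_two, S.diff_stdForm_pow, h3,
    ← invExt_apply, d_invExt, S.diff_smul, S.diff_add, S.diff_smul, S.diff_smul,
    S.diff_delPart, S.diff_delbarPart, ← map_smul]
  congr 1
  rw [powCoeff]
  module

end Nilmanifold

namespace Nilmanifold

/-! ### Products of basic `2`-forms -/

theorem ι_mul_ι_mul_ι_mul_ι (α β γ δ : C5 →L[ℝ] ℂ) :
    (ExteriorAlgebra.ι ℂ α * ExteriorAlgebra.ι ℂ β * (ExteriorAlgebra.ι ℂ γ *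
      ExteriorAlgebra.ι ℂ δ) : FormAlg) =
    -(ExteriorAlgebra.ι ℂ α * ExteriorAlgebra.ι ℂ γ * (ExteriorAlgebra.ι ℂ β *
      ExteriorAlgebra.ι ℂ δ)) := by
  rw [mul_assoc, ← mul_assoc (ExteriorAlgebra.ι ℂ β), ι_mul_ι_swap β γ]
  noncomm_ring

theorem mix_mul_mix (i j k l : Fin 4) : mix i j * mix k l = -(hol i k * antihol j l) :=
  Subtype.ext (ι_mul_ι_mul_ι_mul_ι _ _ _ _)

theorem hol_self (i : Fin 4) : hol i i = 0 := Subtype.ext (ExteriorAlgebra.ι_sq_zero _)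

theorem antihol_self (i : Fin 4) : antihol i i = 0 := Subtype.ext (ExteriorAlgebra.ι_sq_zero _)

theorem hol_swap (i j : Fin 4) : hol i j = -hol j i := Subtype.ext (ι_mul_ι_swap _ _)

theorem antihol_swap (i j : Fin 4) : antihol i j = -antihol j i := Subtype.ext (ι_mul_ι_swap _ _)

theorem mix_mul_hol_left (i j k : Fin 4) : mix i j * hol i k = 0 := by
  apply Subtype.ext
  refine (ι_mul_ι_mul_ι_mul_ι _ _ _ _).trans ?_
  rw [ExteriorAlgebra.ι_sq_zero, zero_mul, neg_zero]
  rfl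

theorem mix_mul_hol_right (i j k : Fin 4) : mix i j * hol k i = 0 := by
  rw [hol_swap, mul_neg, mix_mul_hol_left, neg_zero]

theorem mix_mul_antihol_left (i j k : Fin 4) : mix i j * antihol j k = 0 := by
  apply Subtype.ext
  change ExteriorAlgebra.ι ℂ (dz i.castSucc) * ExteriorAlgebra.ι ℂ (dzBar j.castSucc) *
    (ExteriorAlgebra.ι ℂ (dzBar j.castSucc) * ExteriorAlgebra.ι ℂ (dzBar k.castSucc)) = 0
  rw [mul_assoc, ← mul_assoc (ExteriorAlgebra.ι ℂ (dzBar j.castSucc)),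
    ExteriorAlgebra.ι_sq_zero, zero_mul, mul_zero]

theorem mix_mul_antihol_right (i j k : Fin 4) : mix i j * antihol k j = 0 := by
  rw [antihol_swap, mul_neg, mix_mul_antihol_left, neg_zero]

theorem mix_mul_mix_row (i j k : Fin 4) : mix i j * mix i k = 0 := by
  rw [mix_mul_mix, hol_self, zero_mul, neg_zero]

theorem mix_mul_mix_col (i j k : Fin 4) : mix i j * mix k j = 0 := by
  rw [mix_mul_mix, antihol_self, mul_zero, neg_zero]

theorem mix_mul_mix_swap (k l : Fin 4) : mix k l * mix l k = -(mix k k * mix l l) := by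
  rw [mix_mul_mix, mix_mul_mix, antihol_swap]
  ring

theorem hol_mul_antihol (k l : Fin 4) : hol k l * antihol k l = -(mix k k * mix l l) := by
  rw [mix_mul_mix, neg_neg]

theorem trace_eq : trace = mix 0 0 + mix 1 1 + mix 2 2 + mix 3 3 := by
  rw [trace, Fin.sum_univ_four]

end Nilmanifold

/-! ### Coefficients of the torsion form. -/

namespace StructureConstants

variable (S : StructureConstants)

/-- The coefficient of `η^k ∧ conj η^k ∧ η^l ∧ conj η^l` in `∂ ∂̄ (η^5 ∧ conj η^5)`. -/
def pairCoeff (k l : Fin 4) : ℂ :=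
  (S.coeffHol k l - S.coeffHol l k) * conj (S.coeffHol k l - S.coeffHol l k) +
    S.coeffMix k l * conj (S.coeffMix k l) + S.coeffMix l k * conj (S.coeffMix l k) -
    S.coeffMix k k * conj (S.coeffMix l l) - S.coeffMix l l * conj (S.coeffMix k k)

theorem mul_mul_sub_mul_congr {R : Type*} [CommRing R] {P a b c d a' b' c' d' : R}
    (ha : P * a = P * a') (hb : P * b = P * b') (hc : P * c = P * c') (hd : P * d = P * d') :
    P * (a * b - c * d) = P * (a' * b' - c' * d') := by
  linear_combination b * ha + a' * hb - d * hc - c' * hd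

theorem mix_combination_mul (k l : Fin 4) (p q r s p' q' r' s' : ℂ) :
    (p • mix k k + q • mix k l + r • mix l k + s • mix l l) *
      -(p' • mix k k + q' • mix l k + r' • mix k l + s' • mix l l) =
    (q * q' + r * r' - p * s' - s * p') • (mix k k * mix l l) := by
  simp only [mul_neg, mul_add, add_mul, smul_mul_smul_comm, mix_mul_mix_row, mix_mul_mix_col,
    mix_mul_mix_swap k l, mul_comm (mix l k) (mix k l), mul_comm (mix l l) (mix k k), smul_zero,
    zero_add, add_zero]
  module

theorem hol_combination_mul (k l : Fin 4) (p p' : ℂ) :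
    p • hol k l * p' • antihol k l = -(p * p') • (mix k k * mix l l) := by
  rw [smul_mul_smul_comm, hol_mul_antihol, smul_neg, neg_smul]

/-- The factor η^{i ī} ∧ η^{j j̄} contains dz_i, dz_j and their conjugates, so every monomial
involving i or j dies. What remains of the torsion is its restriction to the indices k and l, a
multiple of η^{k k̄} ∧ η^{l l̄}. -/
theorem mix_mul_mix_mul_torsion {i j k l : Fin 4}
    (hs : ∀ f : Fin 4 → basic, ∑ m, f m = f i + f j + f k + f l) :
    mix i i * mix j j * S.torsion =
      S.pairCoeff k l • (mix i i * mix j j * (mix k k * mix l l)) := by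
  have z1 (m) : mix i i * mix j j * mix i m = 0 := by
    rw [mul_right_comm, mix_mul_mix_row, MulZeroClass.zero_mul]
  have z2 (m) : mix i i * mix j j * mix m i = 0 := by
    rw [mul_right_comm, mix_mul_mix_col, MulZeroClass.zero_mul]
  have z3 (m) : mix i i * mix j j * mix j m = 0 := by
    rw [_root_.mul_assoc, mix_mul_mix_row, mul_zero]
  have z4 (m) : mix i i * mix j j * mix m j = 0 := by
    rw [_root_.mul_assoc, mix_mul_mix_col, mul_zero]
  have y1 (m) : mix i i * mix j j * hol i m = 0 := by
    rw [mul_right_comm, mix_mul_hol_left, MulZeroClass.zero_mul]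
  have y2 (m) : mix i i * mix j j * hol m i = 0 := by
    rw [mul_right_comm, mix_mul_hol_right, MulZeroClass.zero_mul]
  have y3 (m) : mix i i * mix j j * hol j m = 0 := by
    rw [_root_.mul_assoc, mix_mul_hol_left, mul_zero]
  have y4 (m) : mix i i * mix j j * hol m j = 0 := by
    rw [_root_.mul_assoc, mix_mul_hol_right, mul_zero]
  have x1 (m) : mix i i * mix j j * antihol i m = 0 := by
    rw [mul_right_comm, mix_mul_antihol_left, MulZeroClass.zero_mul]
  have x2 (m) : mix i i * mix j j * antihol m i = 0 := by
    rw [mul_right_comm, mix_mul_antihol_right, MulZeroClass.zero_mul]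
  have x3 (m) : mix i i * mix j j * antihol j m = 0 := by
    rw [_root_.mul_assoc, mix_mul_antihol_left, mul_zero]
  have x4 (m) : mix i i * mix j j * antihol m j = 0 := by
    rw [_root_.mul_assoc, mix_mul_antihol_right, mul_zero]
  set P := mix i i * mix j j with hP
  have h1 : P * S.omegaMix = P * (S.coeffMix k k • mix k k + S.coeffMix k l • mix k l +
      S.coeffMix l k • mix l k + S.coeffMix l l • mix l l) := by
    simp only [omegaMix, hs, mul_add, mul_smul_comm, z1, z2, z3, z4, smul_zero, zero_add]
    abel
  have h2 : P * S.omegaMixBar = P * -(conj (S.coeffMix k k) • mix k k +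
      conj (S.coeffMix k l) • mix l k + conj (S.coeffMix l k) • mix k l +
      conj (S.coeffMix l l) • mix l l) := by
    simp only [omegaMixBar, hs, mul_add, mul_neg, mul_smul_comm, z1, z2, z3, z4, smul_zero,
      zero_add]
    abel
  have h3 : P * S.omegaHol = P * ((S.coeffHol k l - S.coeffHol l k) • hol k l) := by
    simp only [omegaHol, hs, mul_add, mul_smul_comm, y1, y2, y3, y4, smul_zero, zero_add,
      hol_self, add_zero, hol_swap l k, mul_neg]
    module
  have h4 : P * S.omegaHolBar =
      P * (conj (S.coeffHol k l - S.coeffHol l k) • antihol k l) := by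
    simp only [omegaHolBar, hs, mul_add, mul_smul_comm, x1, x2, x3, x4, smul_zero, zero_add,
      antihol_self, add_zero, antihol_swap l k, mul_neg, map_sub]
    module
  rw [torsion, mul_mul_sub_mul_congr h1 h2 h3 h4, mix_combination_mul, hol_combination_mul,
    ← sub_smul, mul_smul_comm, pairCoeff]
  congr 1
  ring

/-- The form `η^{1 \bar 1} ∧ ⋯ ∧ η^{4 \bar 4}`. -/
def vol : basic := mix 0 0 * mix 1 1 * mix 2 2 * mix 3 3

theorem sum_fin_four_perm {i j k l : Fin 4} (h : List.Perm [i, j, k, l] [0, 1, 2, 3])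
    (f : Fin 4 → basic) : ∑ m, f m = f i + f j + f k + f l := by
  have h' := (h.map f).sum_eq
  simp only [List.map_cons, List.map_nil, List.sum_cons, List.sum_nil] at h'
  rw [Fin.sum_univ_four]
  linear_combination -h'

theorem pairTerm {i j k l : Fin 4} (h : List.Perm [i, j, k, l] [0, 1, 2, 3]) :
    mix i i * mix j j * S.torsion = S.pairCoeff k l • vol := by
  rw [S.mix_mul_mix_mul_torsion (sum_fin_four_perm h)]
  congr 1
  have h' := (h.map fun m => mix m m).prod_eq
  simp only [List.map_cons, List.map_nil, List.prod_cons, List.prod_nil] at h'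
  rw [vol]
  linear_combination h'

/-- The squares of the η^{i ī} vanish, so the square of the trace is twice the sum over pairs; each
pair picks out the coefficient of the complementary one. -/
theorem trace_sq_mul_torsion : trace ^ 2 * S.torsion =
    (2 * (S.pairCoeff 0 1 + S.pairCoeff 0 2 + S.pairCoeff 0 3 + S.pairCoeff 1 2 +
      S.pairCoeff 1 3 + S.pairCoeff 2 3)) • vol := by
  have h01 := S.pairTerm (i := 0) (j := 1) (k := 2) (l := 3) (by decide)
  have h02 := S.pairTerm (i := 0) (j := 2) (k := 1) (l := 3) (by decide)
  have h03 := S.pairTerm (i := 0) (j := 3) (k := 1) (l := 2) (by decide)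
  have h12 := S.pairTerm (i := 1) (j := 2) (k := 0) (l := 3) (by decide)
  have h13 := S.pairTerm (i := 1) (j := 3) (k := 0) (l := 2) (by decide)
  have h23 := S.pairTerm (i := 2) (j := 3) (k := 0) (l := 1) (by decide)
  have e : trace ^ 2 * S.torsion = 2 * (mix 0 0 * mix 1 1 * S.torsion +
      mix 0 0 * mix 2 2 * S.torsion + mix 0 0 * mix 3 3 * S.torsion +
      mix 1 1 * mix 2 2 * S.torsion + mix 1 1 * mix 3 3 * S.torsion +
      mix 2 2 * mix 3 3 * S.torsion) := by
    rw [trace_eq]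
    linear_combination S.torsion * (mix_mul_mix_row 0 0 0 + mix_mul_mix_row 1 1 1 +
      mix_mul_mix_row 2 2 2 + mix_mul_mix_row 3 3 3)
  rw [e, h01, h02, h03, h12, h13, h23, two_mul]
  module

theorem mix_mul_trace_mul_torsion {i j k l : Fin 4} (h : List.Perm [i, j, k, l] [0, 1, 2, 3]) :
    trace * S.torsion * mix i i =
      (S.pairCoeff j k + S.pairCoeff j l + S.pairCoeff k l) • vol := by
  have hj := S.pairTerm h
  have hk := S.pairTerm (i := i) (j := k) (k := j) (l := l)
    (((List.Perm.swap j k [l]).cons i).trans h)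
  have hl := S.pairTerm (i := i) (j := l) (k := j) (l := k)
    ((((List.Perm.swap j l [k]).trans ((List.Perm.swap k l []).cons j)).cons i).trans h)
  have e : trace * S.torsion * mix i i = mix i i * mix j j * S.torsion +
      mix i i * mix k k * S.torsion + mix i i * mix l l * S.torsion := by
    rw [trace, sum_fin_four_perm h]
    linear_combination S.torsion * mix_mul_mix_row i i i
  rw [e, hj, hk, hl]
  module

end StructureConstants

namespace StructureConstants

/-! ### Nonvanishing of the volume form -/

theorem coe_vol : (vol : FormAlg) = ExteriorAlgebra.ιMulti ℂ 8 fun i : Fin 8 =>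
    (![dz ((finProdFinEquiv (m := 4) (n := 2)).symm i).1.castSucc,
      dzBar ((finProdFinEquiv (m := 4) (n := 2)).symm i).1.castSucc] : Fin 2 → C5 →L[ℝ] ℂ)
      ((finProdFinEquiv (m := 4) (n := 2)).symm i).2 := by
  rw [ExteriorAlgebra.ιMulti_apply, List.ofFn_eq_map]
  change _ = ExteriorAlgebra.ι ℂ (dz 0) * (ExteriorAlgebra.ι ℂ (dzBar 0) *
    (ExteriorAlgebra.ι ℂ (dz 1) * (ExteriorAlgebra.ι ℂ (dzBar 1) *
    (ExteriorAlgebra.ι ℂ (dz 2) * (ExteriorAlgebra.ι ℂ (dzBar 2) *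
    (ExteriorAlgebra.ι ℂ (dz 3) * (ExteriorAlgebra.ι ℂ (dzBar 3) * 1)))))))
  rw [vol, MulMemClass.coe_mul, MulMemClass.coe_mul, MulMemClass.coe_mul]
  simp only [_root_.mul_assoc, mul_one]
  change ExteriorAlgebra.ι ℂ (dz 0) * ExteriorAlgebra.ι ℂ (dzBar 0) *
    (ExteriorAlgebra.ι ℂ (dz 1) * ExteriorAlgebra.ι ℂ (dzBar 1) *
    (ExteriorAlgebra.ι ℂ (dz 2) * ExteriorAlgebra.ι ℂ (dzBar 2) *
    (ExteriorAlgebra.ι ℂ (dz 3) * ExteriorAlgebra.ι ℂ (dzBar 3)))) = _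
  simp only [_root_.mul_assoc]

theorem extForm_vol_ne_zero : extForm 8 (vol : FormAlg) ≠ 0 := by
  let α : Fin 4 × Fin 2 → C5 →L[ℝ] ℂ := fun p => ![dz p.1.castSucc, dzBar p.1.castSucc] p.2
  let w : Fin 4 × Fin 2 → C5 := fun p => Pi.single p.1.castSucc (![1, Complex.I] p.2)
  have h1 : extForm 8 (vol : FormAlg)
      -- On the vectors e_j and i e_j the matrix of the forms dz_j, conj dz_j is block diagonal,
      -- with four 2 × 2 blocks of determinant -2i, so the value is 16.
      (fun i : Fin 8 => w ((finProdFinEquiv (m := 4) (n := 2)).symm i)) =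
      (Matrix.of fun p p' => α p (w p')).det := by
    rw [coe_vol, extForm_ιMulti, detForm_apply]
    exact Matrix.det_submatrix_equiv_self (finProdFinEquiv.symm : Fin (4 * 2) ≃ Fin 4 × Fin 2)
      (Matrix.of fun p p' => α p (w p'))
  have h2 : (Matrix.of fun p p' => α p (w p')) = (Matrix.blockDiagonal fun _ : Fin 4 =>
      !![1, Complex.I; 1, -Complex.I]).submatrix (Equiv.prodComm _ _) (Equiv.prodComm _ _) := by
    ext ⟨h, b⟩ ⟨h', b'⟩
    by_cases hh : h = h'
    · subst hh
      fin_cases b <;> fin_cases b' <;> simp [α, w, Matrix.blockDiagonal_apply]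
    · have hc : h.castSucc ≠ h'.castSucc := fun e => hh (Fin.castSucc_injective 4 e)
      fin_cases b <;> simp [α, w, Matrix.blockDiagonal_apply, hh]
  intro h
  rw [h, h2, Matrix.det_submatrix_equiv_self, Matrix.det_blockDiagonal] at h1
  have e : (-Complex.I - Complex.I) ^ 4 = 16 := by
    linear_combination 16 * (Complex.I ^ 2 - 1) * Complex.I_sq
  simp [Matrix.det_fin_two, e] at h1

theorem extForm_smul_vol_eq_zero {c : ℂ} :
    extForm 8 (((c • vol : basic)) : FormAlg) = 0 ↔ c = 0 := by
  rw [Subalgebra.coe_smul, map_smul]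
  constructor
  · intro h
    by_contra hc
    apply extForm_vol_ne_zero
    ext v
    have hv := congrArg (fun f => f v) h
    simpa [hc] using hv
  · rintro rfl
    ext v
    simp

variable (S : StructureConstants)

/-! ### Degrees -/

theorem mix_mem (j k : Fin 4) : (mix j k : FormAlg) ∈ ⋀[ℂ]^2 (C5 →L[ℝ] ℂ) := ι_mul_ι_mem _ _

theorem sum_smul_mem {f : Fin 4 → Fin 4 → basic} (c : Fin 4 → Fin 4 → ℂ)
    (hf : ∀ j k, (f j k : FormAlg) ∈ ⋀[ℂ]^2 (C5 →L[ℝ] ℂ)) :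
    ((∑ j, ∑ k, c j k • f j k : basic) : FormAlg) ∈ ⋀[ℂ]^2 (C5 →L[ℝ] ℂ) := by
  rw [AddSubmonoidClass.coe_finsetSum]
  refine Submodule.sum_mem _ fun j _ => ?_
  rw [AddSubmonoidClass.coe_finsetSum]
  exact Submodule.sum_mem _ fun k _ => Submodule.smul_mem _ _ (hf j k)

theorem coe_mul_mem {a b : basic} {k l : ℕ} (ha : (a : FormAlg) ∈ ⋀[ℂ]^k (C5 →L[ℝ] ℂ))
    (hb : (b : FormAlg) ∈ ⋀[ℂ]^l (C5 →L[ℝ] ℂ)) :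
    ((a * b : basic) : FormAlg) ∈ ⋀[ℂ]^(k + l) (C5 →L[ℝ] ℂ) := by
  rw [MulMemClass.coe_mul, ExteriorAlgebra.exteriorPower, pow_add]
  exact Submodule.mul_mem_mul ha hb

theorem torsion_mem : (S.torsion : FormAlg) ∈ ⋀[ℂ]^4 (C5 →L[ℝ] ℂ) := by
  have h1 : (S.omegaHol : FormAlg) ∈ ⋀[ℂ]^2 (C5 →L[ℝ] ℂ) :=
    sum_smul_mem _ fun j k => ι_mul_ι_mem _ _
  have h2 : (S.omegaMix : FormAlg) ∈ ⋀[ℂ]^2 (C5 →L[ℝ] ℂ) := sum_smul_mem _ mix_mem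
  have h3 : (S.omegaHolBar : FormAlg) ∈ ⋀[ℂ]^2 (C5 →L[ℝ] ℂ) :=
    sum_smul_mem (fun j k => conj (S.coeffHol j k)) fun j k => ι_mul_ι_mem _ _
  have h4 : (S.omegaMixBar : FormAlg) ∈ ⋀[ℂ]^2 (C5 →L[ℝ] ℂ) := by
    rw [omegaMixBar, NegMemClass.coe_neg]
    exact Submodule.neg_mem _ (sum_smul_mem (fun j k => conj (S.coeffMix j k))
      fun j k => mix_mem k j)
  rw [torsion, AddSubgroupClass.coe_sub]
  exact Submodule.sub_mem _ (coe_mul_mem h2 h4) (coe_mul_mem h1 h3)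

theorem trace_mem : (trace : FormAlg) ∈ ⋀[ℂ]^2 (C5 →L[ℝ] ℂ) := by
  rw [trace, AddSubmonoidClass.coe_finsetSum]
  exact Submodule.sum_mem _ fun j _ => mix_mem j j

theorem extForm_mul_eq_zero {a : basic} (b : basic) {k l : ℕ}
    (ha : (a : FormAlg) ∈ ⋀[ℂ]^k (C5 →L[ℝ] ℂ)) (hb : (b : FormAlg) ∈ ⋀[ℂ]^l (C5 →L[ℝ] ℂ))
    (h : extForm k (a : FormAlg) = 0) : extForm (k + l) ((a * b : basic) : FormAlg) = 0 := by
  rw [MulMemClass.coe_mul, extForm_mul ha hb, h, wedgeAlt_zero_left]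

/-- Wedging the 6-form with η^{i ī} gives a multiple of the volume form, whose coefficient must
vanish. No constant needs to be zero for this direction. -/
theorem pairCoeff_sum_eq_zero (h : extForm 6 ((trace * S.torsion : basic) : FormAlg) = 0)
    {i j k l : Fin 4} (hp : List.Perm [i, j, k, l] [0, 1, 2, 3]) :
    S.pairCoeff j k + S.pairCoeff j l + S.pairCoeff k l = 0 := by
  have h8 := extForm_mul_eq_zero (mix i i) (coe_mul_mem trace_mem S.torsion_mem) (mix_mem i i) h
  rw [S.mix_mul_trace_mul_torsion hp] at h8
  exact extForm_smul_vol_eq_zero.1 h8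

/-! ### The special case -/

theorem trace_mul_combination (p₀₁ p₀₂ p₀₃ p₁₂ p₁₃ p₂₃ : ℂ) :
    trace * (p₀₁ • (mix 0 0 * mix 1 1) + p₀₂ • (mix 0 0 * mix 2 2) + p₀₃ • (mix 0 0 * mix 3 3) +
      p₁₂ • (mix 1 1 * mix 2 2) + p₁₃ • (mix 1 1 * mix 3 3) + p₂₃ • (mix 2 2 * mix 3 3)) =
    (p₀₁ + p₀₂ + p₁₂) • (mix 0 0 * mix 1 1 * mix 2 2) +
      (p₀₁ + p₀₃ + p₁₃) • (mix 0 0 * mix 1 1 * mix 3 3) +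
      (p₀₂ + p₀₃ + p₂₃) • (mix 0 0 * mix 2 2 * mix 3 3) +
      (p₁₂ + p₁₃ + p₂₃) • (mix 1 1 * mix 2 2 * mix 3 3) := by
  have h0 := mix_mul_mix_row 0 0 0
  have h1 := mix_mul_mix_row 1 1 1
  have h2 := mix_mul_mix_row 2 2 2
  have h3 := mix_mul_mix_row 3 3 3
  have e01 : trace * (mix 0 0 * mix 1 1) =
      mix 0 0 * mix 1 1 * mix 2 2 + mix 0 0 * mix 1 1 * mix 3 3 := by
    rw [trace_eq]
    linear_combination mix 1 1 * h0 + mix 0 0 * h1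
  have e02 : trace * (mix 0 0 * mix 2 2) =
      mix 0 0 * mix 1 1 * mix 2 2 + mix 0 0 * mix 2 2 * mix 3 3 := by
    rw [trace_eq]
    linear_combination mix 2 2 * h0 + mix 0 0 * h2
  have e03 : trace * (mix 0 0 * mix 3 3) =
      mix 0 0 * mix 1 1 * mix 3 3 + mix 0 0 * mix 2 2 * mix 3 3 := by
    rw [trace_eq]
    linear_combination mix 3 3 * h0 + mix 0 0 * h3
  have e12 : trace * (mix 1 1 * mix 2 2) =
      mix 0 0 * mix 1 1 * mix 2 2 + mix 1 1 * mix 2 2 * mix 3 3 := by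
    rw [trace_eq]
    linear_combination mix 2 2 * h1 + mix 1 1 * h2
  have e13 : trace * (mix 1 1 * mix 3 3) =
      mix 0 0 * mix 1 1 * mix 3 3 + mix 1 1 * mix 2 2 * mix 3 3 := by
    rw [trace_eq]
    linear_combination mix 3 3 * h1 + mix 1 1 * h3
  have e23 : trace * (mix 2 2 * mix 3 3) =
      mix 0 0 * mix 2 2 * mix 3 3 + mix 1 1 * mix 2 2 * mix 3 3 := by
    rw [trace_eq]
    linear_combination mix 3 3 * h2 + mix 2 2 * h3
  simp only [mul_add, mul_smul_comm, e01, e02, e03, e12, e13, e23]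
  module

/-- Each summand of the trace repeats one of the factors dz_j or conj dz_j. -/
theorem trace_mul_hol_mul_antihol :
    trace * (hol 0 1 * antihol 2 3) = 0 ∧ trace * (hol 2 3 * antihol 0 1) = 0 := by
  rw [trace_eq]
  constructor
  · linear_combination antihol 2 3 * (mix_mul_hol_left 0 0 1 + mix_mul_hol_right 1 1 0) +
      hol 0 1 * (mix_mul_antihol_left 2 2 3 + mix_mul_antihol_right 3 3 2)
  · linear_combination antihol 0 1 * (mix_mul_hol_left 2 2 3 + mix_mul_hol_right 3 3 2) +
      hol 2 3 * (mix_mul_antihol_left 0 0 1 + mix_mul_antihol_right 1 1 0)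

theorem combination_mul_sub (a b c e a' b' c' e' p q p' q' : ℂ) :
    (a • mix 0 0 + b • mix 1 1 + c • mix 2 2 + e • mix 3 3) *
      -(a' • mix 0 0 + b' • mix 1 1 + c' • mix 2 2 + e' • mix 3 3) -
      (p • hol 0 1 + q • hol 2 3) * (p' • antihol 0 1 + q' • antihol 2 3) =
    ((p * p' - a * b' - b * a') • (mix 0 0 * mix 1 1) + (-a * c' - c * a') • (mix 0 0 * mix 2 2) +
      (-a * e' - e * a') • (mix 0 0 * mix 3 3) + (-b * c' - c * b') • (mix 1 1 * mix 2 2) +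
      (-b * e' - e * b') • (mix 1 1 * mix 3 3) +
      (q * q' - c * e' - e * c') • (mix 2 2 * mix 3 3)) -
      ((p * q') • (hol 0 1 * antihol 2 3) + (q * p') • (hol 2 3 * antihol 0 1)) := by
  simp only [mul_neg, mul_add, add_mul, smul_mul_smul_comm, mix_mul_mix_row, smul_zero,
    hol_mul_antihol, mul_comm (mix 1 1) (mix 0 0), mul_comm (mix 2 2) (mix 0 0),
    mul_comm (mix 3 3) (mix 0 0), mul_comm (mix 2 2) (mix 1 1), mul_comm (mix 3 3) (mix 1 1),
    mul_comm (mix 3 3) (mix 2 2)]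
  module

/-- With these constants zero, the torsion is a combination of the η^{k k̄} ∧ η^{l l̄} and of two
cross terms killed by the trace. The product then has only four coefficients, the triple sums
assumed to vanish; the subscript of each such hypothesis is the omitted index. -/
theorem trace_mul_torsion_eq_zero (a₂ : S.a₂ = 0) (a₃ : S.a₃ = 0) (a₅ : S.a₅ = 0) (a₆ : S.a₆ = 0)
    (a₇ : S.a₇ = 0) (b₁ : S.b₁ = 0) (b₂ : S.b₂ = 0) (b₃ : S.b₃ = 0) (b₅ : S.b₅ = 0)
    (b₆ : S.b₆ = 0) (c₂ : S.c₂ = 0) (c₃ : S.c₃ = 0) (c₅ : S.c₅ = 0) (d₁ : S.d₁ = 0)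
    (d₂ : S.d₂ = 0) (d₃ : S.d₃ = 0)
    (h₃ : S.pairCoeff 0 1 + S.pairCoeff 0 2 + S.pairCoeff 1 2 = 0)
    (h₂ : S.pairCoeff 0 1 + S.pairCoeff 0 3 + S.pairCoeff 1 3 = 0)
    (h₁ : S.pairCoeff 0 2 + S.pairCoeff 0 3 + S.pairCoeff 2 3 = 0)
    (h₀ : S.pairCoeff 1 2 + S.pairCoeff 1 3 + S.pairCoeff 2 3 = 0) :
    trace * S.torsion = 0 := by
  have hM : S.omegaMix = S.a₄ • mix 0 0 + S.b₄ • mix 1 1 + S.c₄ • mix 2 2 + S.d₄ • mix 3 3 := by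
    simp [omegaMix, Fin.sum_univ_four, coeffMix, *]
  have hN : S.omegaMixBar = -(conj S.a₄ • mix 0 0 + conj S.b₄ • mix 1 1 + conj S.c₄ • mix 2 2 +
      conj S.d₄ • mix 3 3) := by
    simp [omegaMixBar, Fin.sum_univ_four, coeffMix, *]
  have hH : S.omegaHol = S.a₁ • hol 0 1 + S.c₁ • hol 2 3 := by
    simp [omegaHol, Fin.sum_univ_four, coeffHol, *]
  have hK : S.omegaHolBar = conj S.a₁ • antihol 0 1 + conj S.c₁ • antihol 2 3 := by
    simp [omegaHolBar, Fin.sum_univ_four, coeffHol, *]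
  rw [torsion, hM, hN, hH, hK, combination_mul_sub, mul_sub, trace_mul_combination, mul_add,
    mul_smul_comm, mul_smul_comm, trace_mul_hol_mul_antihol.1, trace_mul_hol_mul_antihol.2]
  simp only [pairCoeff, coeffHol, coeffMix, Matrix.cons_val, a₂, a₃, a₅, a₆, a₇, b₁, b₂, b₃, b₅,
    b₆, c₂, c₃, c₅, d₁, d₂, d₃, map_zero, mul_zero, sub_zero, zero_add, zero_sub] at h₀ h₁ h₂ h₃
  -- The hypotheses are brought to the exact shape of the coefficients left by
  -- `trace_mul_combination`.
  have e₃ : S.a₁ * conj S.a₁ - S.a₄ * conj S.b₄ - S.b₄ * conj S.a₄ +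
      (-S.a₄ * conj S.c₄ - S.c₄ * conj S.a₄) + (-S.b₄ * conj S.c₄ - S.c₄ * conj S.b₄) = 0 := by
    linear_combination h₃
  have e₂ : S.a₁ * conj S.a₁ - S.a₄ * conj S.b₄ - S.b₄ * conj S.a₄ +
      (-S.a₄ * conj S.d₄ - S.d₄ * conj S.a₄) + (-S.b₄ * conj S.d₄ - S.d₄ * conj S.b₄) = 0 := by
    linear_combination h₂
  have e₁ : -S.a₄ * conj S.c₄ - S.c₄ * conj S.a₄ + (-S.a₄ * conj S.d₄ - S.d₄ * conj S.a₄) +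
      (S.c₁ * conj S.c₁ - S.c₄ * conj S.d₄ - S.d₄ * conj S.c₄) = 0 := by
    linear_combination h₁
  have e₀ : -S.b₄ * conj S.c₄ - S.c₄ * conj S.b₄ + (-S.b₄ * conj S.d₄ - S.d₄ * conj S.b₄) +
      (S.c₁ * conj S.c₁ - S.c₄ * conj S.d₄ - S.d₄ * conj S.c₄) = 0 := by
    linear_combination h₀
  rw [e₃, e₂, e₁, e₀]
  simp

/-- `pairCoeff` is real. -/
def pairReal (k l : Fin 4) : ℝ :=
  ‖S.coeffHol k l - S.coeffHol l k‖ ^ 2 + ‖S.coeffMix k l‖ ^ 2 + ‖S.coeffMix l k‖ ^ 2 -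
    2 * (S.coeffMix l l * conj (S.coeffMix k k)).re

theorem pairCoeff_eq (k l : Fin 4) : S.pairCoeff k l = (S.pairReal k l : ℂ) := by
  have h := Complex.add_conj (S.coeffMix l l * conj (S.coeffMix k k))
  simp only [map_mul, Complex.conj_conj] at h
  rw [pairCoeff, pairReal, Complex.mul_conj, Complex.mul_conj, Complex.mul_conj,
    Complex.normSq_eq_norm_sq, Complex.normSq_eq_norm_sq, Complex.normSq_eq_norm_sq]
  push_cast at h ⊢
  linear_combination -h

end StructureConstants

/-! ### The structure equations, and the conditions as vanishing of algebraic forms. -/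

namespace Nilmanifold

variable {S : StructureConstants} (Γ : Subgroup (NilGroup S)) [DiscreteTopology Γ]

theorem smul_invExt_eq_zero {c : ℂ} (hc : c ≠ 0) (k : ℕ) (a : FormAlg) :
    c • invExt Γ k a = 0 ↔ extForm k a = 0 := by
  rw [← map_smul, invExt_apply, invForm_eq_zero, map_smul]
  constructor
  · intro h
    ext v
    have hv := congrArg (fun f => f v) h
    simpa [hc] using hv
  · intro h
    ext v
    simp [h]

theorem structureForm_eq :
    structureForm Γ = invExt Γ 2 ((S.omegaHol + S.omegaMix : basic) : FormAlg) := by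
  have h : ((S.omegaHol + S.omegaMix : basic) : FormAlg) =
      ∑ j : Fin 4, ∑ k : Fin 4, (S.coeffHol j k • (zeta j.castSucc * zeta k.castSucc) +
        S.coeffMix j k • (zeta j.castSucc * zetaBar k.castSucc)) := by
    simp only [StructureConstants.omegaHol, StructureConstants.omegaMix, AddMemClass.coe_add,
      AddSubmonoidClass.coe_finsetSum, Subalgebra.coe_smul, Finset.sum_add_distrib]
    rfl
  have h0 : Fin.castSucc (0 : Fin 4) = 0 := rfl
  have h1 : Fin.castSucc (1 : Fin 4) = 1 := rfl
  have h2 : Fin.castSucc (2 : Fin 4) = 2 := rfl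
  have h3 : Fin.castSucc (3 : Fin 4) = 3 := rfl
  simp only [h, map_add, map_smul, invExt_apply, ← wedge_etaForm_etaForm,
    ← wedge_etaForm_etaBar, Fin.sum_univ_four, h0, h1, h2, h3, StructureConstants.coeffHol,
    StructureConstants.coeffMix, Matrix.cons_val, zero_smul, structureForm,
    zero_add]
  abel

theorem d_etaForm (j : Fin 5) : d (etaForm Γ j) = invExt Γ 2 (S.diff (zeta j)) := by
  rw [etaForm_eq]
  exact d_invExt Γ 1 (zeta j)

theorem d_etaForm_of_ne {j : Fin 5} (hj : j ≠ 4) : d (etaForm Γ j) = 0 := by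
  have h1 : contr (zeta j) = 0 := by
    simpa [zeta, contr_one, lastCoeff_dz, hj] using contr_ι_mul (dz j) 1
  have h2 : contrBar (zeta j) = 0 := by
    simpa [zeta, contrBar_one, lastCoeffBar_dz] using contrBar_ι_mul (dz j) 1
  rw [d_etaForm, StructureConstants.diff, h1, h2, mul_zero, mul_zero, add_zero, map_zero]

theorem d_etaForm_four : d (etaForm Γ 4) = structureForm Γ := by
  rw [d_etaForm, structureForm_eq, StructureConstants.diff, contr_zeta, contrBar_zeta, mul_one,
    mul_zero, add_zero]

theorem extForm_trace_sq_mul_torsion_eq_zero :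
    extForm 8 ((trace ^ 2 * S.torsion : basic) : FormAlg) = 0 ↔
      S.pairReal 0 1 + S.pairReal 0 2 + S.pairReal 0 3 + S.pairReal 1 2 + S.pairReal 1 3 +
        S.pairReal 2 3 = 0 := by
  rw [S.trace_sq_mul_torsion, StructureConstants.extForm_smul_vol_eq_zero]
  simp only [S.pairCoeff_eq]
  rw [mul_eq_zero_iff_left two_ne_zero]
  exact_mod_cast Iff.rfl

theorem isAsthenoKahler_iff :
    IsAsthenoKahler 5 (complexStructure Γ) (diagonalMetric Γ) ↔
      extForm 8 ((trace ^ 2 * S.torsion : basic) : FormAlg) = 0 := by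
  -- The exponent 5 - 2 = 3 is n + 1 with n = 2, and the degree 2 · 3 + 2 is 8.
  have h := (del_delbar_wedgePow Γ 2).symm ▸ smul_invExt_eq_zero Γ (powCoeff_ne_zero 2) 8
    ((trace ^ 2 * S.torsion : basic) : FormAlg)
  refine Iff.trans ?_ h
  constructor
  · rintro ⟨-, F, hF, h⟩
    rw [eq_diagonalForm Γ hF] at h
    exact h
  · exact fun h => ⟨isHermitianMetric_diagonalMetric Γ, _, isFundamentalForm_diagonalForm Γ, h⟩

theorem d_dc_wedgePow_eq_zero (n : ℕ) :
    d (dc (complexStructure Γ) (wedgePow (diagonalForm Γ) (n + 1))) = 0 ↔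
      extForm (2 * (n + 1) + 1 + 1) ((trace ^ n * S.torsion : basic) : FormAlg) = 0 := by
  rw [d_dc_wedgePow]
  exact smul_invExt_eq_zero Γ (mul_ne_zero (mul_ne_zero two_ne_zero Complex.I_ne_zero)
    (powCoeff_ne_zero n)) _ _

end Nilmanifold

end

/-! ### The two equivalences. -/

theorem mainTheorem2 (S : StructureConstants) (Γ : Subgroup (NilGroup S)) [DiscreteTopology Γ]
    [CompactSpace (Nilmanifold Γ)] :
    -- the structure equations hold on `M = Γ \ G`, and the `η^j` are of type `(1, 0)` for `J`
    ((∀ j : Fin 5, j ≠ 4 → d (etaForm Γ j) = 0) ∧ d (etaForm Γ 4) = structureForm Γ ∧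
      ∀ (j : Fin 5) (x : Nilmanifold Γ) (X : TangentSpace 𝓘(ℝ, C5) x),
        eta Γ j x (complexStructure Γ x X) = Complex.I * eta Γ j x X) ∧
    -- `g` is a Hermitian metric with fundamental form `F`
    IsHermitianMetric (complexStructure Γ) (diagonalMetric Γ) ∧
    IsFundamentalForm (complexStructure Γ) (diagonalMetric Γ) (diagonalForm Γ) ∧
    -- the astheno-Kähler condition
    (IsAsthenoKahler 5 (complexStructure Γ) (diagonalMetric Γ) ↔
      2 * (S.d₄ * conj S.a₄ + S.d₄ * conj S.b₄ + S.d₄ * conj S.c₄ + S.c₄ * conj S.a₄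
          + S.c₄ * conj S.b₄ + S.b₄ * conj S.a₄).re =
        ‖S.a₁‖ ^ 2 + ‖S.a₂‖ ^ 2 + ‖S.a₃‖ ^ 2 + ‖S.a₅‖ ^ 2 + ‖S.a₆‖ ^ 2 + ‖S.a₇‖ ^ 2
        + ‖S.b₁‖ ^ 2 + ‖S.b₂‖ ^ 2 + ‖S.b₃‖ ^ 2 + ‖S.b₅‖ ^ 2 + ‖S.b₆‖ ^ 2
        + ‖S.c₁‖ ^ 2 + ‖S.c₂‖ ^ 2 + ‖S.c₃‖ ^ 2 + ‖S.c₅‖ ^ 2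
        + ‖S.d₁‖ ^ 2 + ‖S.d₂‖ ^ 2 + ‖S.d₃‖ ^ 2) ∧
    -- the special case
    (S.a₂ = 0 → S.a₃ = 0 → S.a₅ = 0 → S.a₆ = 0 → S.a₇ = 0 →
      S.b₁ = 0 → S.b₂ = 0 → S.b₃ = 0 → S.b₅ = 0 → S.b₆ = 0 →
      S.c₂ = 0 → S.c₃ = 0 → S.c₅ = 0 → S.d₁ = 0 → S.d₂ = 0 → S.d₃ = 0 →
      ((d (dc (complexStructure Γ) (wedgePow (diagonalForm Γ) 3)) = 0 ∧
          d (dc (complexStructure Γ) (wedgePow (diagonalForm Γ) 2)) = 0) ↔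
        2 * (S.d₄ * conj S.a₄ + S.d₄ * conj S.b₄ + S.d₄ * conj S.c₄ + S.c₄ * conj S.a₄
            + S.c₄ * conj S.b₄ + S.b₄ * conj S.a₄).re = ‖S.a₁‖ ^ 2 + ‖S.c₁‖ ^ 2 ∧
        2 * (S.c₄ * conj S.a₄ + S.c₄ * conj S.b₄ + S.b₄ * conj S.a₄).re = ‖S.a₁‖ ^ 2 ∧
        (S.c₄ * conj S.b₄ - S.d₄ * conj S.a₄).re = 0 ∧
        (S.b₄ * conj S.d₄ - S.c₄ * conj S.a₄).re = 0)) := by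
  refine ⟨⟨fun j hj => d_etaForm_of_ne Γ hj, d_etaForm_four Γ, eta_complexStructure Γ⟩,
    isHermitianMetric_diagonalMetric Γ, isFundamentalForm_diagonalForm Γ, ?_, ?_⟩
  · rw [isAsthenoKahler_iff, extForm_trace_sq_mul_torsion_eq_zero]
    simp only [StructureConstants.pairReal, StructureConstants.coeffHol,
      StructureConstants.coeffMix, Matrix.cons_val, sub_zero, Complex.add_re]
    constructor <;> intro h <;> linarith
  · intro a₂ a₃ a₅ a₆ a₇ b₁ b₂ b₃ b₅ b₆ c₂ c₃ c₅ d₁ d₂ d₃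
    have h3 := (d_dc_wedgePow_eq_zero Γ 2).trans extForm_trace_sq_mul_torsion_eq_zero
    have h2 := d_dc_wedgePow_eq_zero Γ 1
    rw [pow_one] at h2
    rw [h3, h2]
    have hs : (S.b₄ * conj S.d₄).re = (S.d₄ * conj S.b₄).re := by
      simp [mul_comm]
    have hp : S.pairReal 0 1 = ‖S.a₁‖ ^ 2 - 2 * (S.b₄ * conj S.a₄).re ∧
        S.pairReal 0 2 = -2 * (S.c₄ * conj S.a₄).re ∧
        S.pairReal 0 3 = -2 * (S.d₄ * conj S.a₄).re ∧
        S.pairReal 1 2 = -2 * (S.c₄ * conj S.b₄).re ∧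
        S.pairReal 1 3 = -2 * (S.d₄ * conj S.b₄).re ∧
        S.pairReal 2 3 = ‖S.c₁‖ ^ 2 - 2 * (S.d₄ * conj S.c₄).re := by
      simp [StructureConstants.pairReal, StructureConstants.coeffHol,
        StructureConstants.coeffMix, *]
    obtain ⟨h01, h02, h03, h12, h13, h23⟩ := hp
    simp only [Complex.add_re, Complex.sub_re, hs]
    constructor
    -- The condition on F² suffices here: the four triple sums count each pair twice, so half their
    -- sum is the total that governs F³. Differences of the sums give the last two equations.
    · rintro ⟨-, h⟩
      have t3 := S.pairCoeff_sum_eq_zero h (i := 3) (j := 0) (k := 1) (l := 2) (by decide)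
      have t2 := S.pairCoeff_sum_eq_zero h (i := 2) (j := 0) (k := 1) (l := 3) (by decide)
      have t1 := S.pairCoeff_sum_eq_zero h (i := 1) (j := 0) (k := 2) (l := 3) (by decide)
      have t0 := S.pairCoeff_sum_eq_zero h (i := 0) (j := 1) (k := 2) (l := 3) (by decide)
      simp only [S.pairCoeff_eq] at t0 t1 t2 t3
      norm_cast at t0 t1 t2 t3
      refine ⟨?_, ?_, ?_, ?_⟩ <;> linarith
    -- The last two equations say that the coefficients of the pairs {0, 3} and {1, 2} agree, and
    -- likewise those of {0, 2} and {1, 3}. With the total and the sum over the indices 0, 1, 2 they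
    -- give the remaining three triple sums.
    · rintro ⟨e1, e2, e3, e4⟩
      refine ⟨by linarith, ?_⟩
      rw [S.trace_mul_torsion_eq_zero a₂ a₃ a₅ a₆ a₇ b₁ b₂ b₃ b₅ b₆ c₂ c₃ c₅ d₁ d₂ d₃,
        ZeroMemClass.coe_zero, map_zero]
      all_goals
        simp only [S.pairCoeff_eq]
        norm_cast
        linarith
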